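/- Let $\mathrm{PA}$ be first-order Peano arithmetic. A \emph{universal} ($\Pi_1$) sentence is a block of universal quantifiers followed by a formula with bounded quantifiers only; existential ($\Sigma_1$) formulas are defined in the same way. Binary strings are identified with natural numbers in the standard way (the string $s$ corresponds to the number $m$ such that $m+1$ has binary expansion $1s$). A \emph{programming language} is a $\Sigma_1$ formula $U(p,x)$ ("the program $p$ terminates with output $x$") such that $\mathrm{PA}$ proves that every $p$ has at most one output; it is \emph{prefix-free} if $\mathrm{PA}$ proves that no terminating program is a proper prefix of another terminating program. The language $U$ is \emph{optimal} if for every programming language $V$ there is a constant $c$ such that $\mathrm{PA}$ proves: whenever $V(p,x)$, there is a $q$ of length at most $|p|+c$ with $U(q,x)$. A prefix-free language is \emph{optimal among prefix-free languages} if this holds for every prefix-free $V$. Let $\mathrm{K}(x)$ be the minimal length of a program $p$ for which $U(p,x)$ is true, and, for numerals $k$, let "$\mathrm{K}(x)=k$" and "$\mathrm{K}(x)>k$" be the arithmetical sentences that express these statements through $U$. Let $U$ be an optimal programming language (so that $\mathrm{K}$ is plain Kolmogorov complexity), or a prefix-free language that is optimal among prefix-free languages (so that $\mathrm{K}$ is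 prefix complexity). Then: (1) The theory obtained from $\mathrm{PA}$ by adding, for each binary string $x$, the axiom "$\mathrm{K}(x)=k$", where $k$ is the numeral for the true complexity of $x$, has the same theorems as the theory obtained from $\mathrm{PA}$ by adding all universal sentences that are true in $\mathbb{N}$. (2) The same holds if, instead, for each string $x$ with $\mathrm{K}(x)>0$ one only adds some true axiom "$\mathrm{K}(x)>c_x$", where $c_x\ge \mathrm{K}(x)/2$; here $c_x$ are arbitrary real numbers with $\mathrm{K}(x)/2\le c_x<\mathrm{K}(x)$, and "$\mathrm{K}(x)>c_x$" is written as "$\mathrm{K}(x)>\lfloor c_x\rfloor$". -/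

import Mathlib

namespace KolmogorovArithmetic

open FirstOrder FirstOrder.Language

/-! ### First-order arithmetic -/

/-- Function symbols of arithmetic: `0`, `S`, `+`, `·`. -/
inductive ArithFunc : ℕ → Type
  | zero : ArithFunc 0
  | succ : ArithFunc 1
  | add : ArithFunc 2
  | mul : ArithFunc 2

/-- Relation symbols of arithmetic (besides equality): `≤`. -/
inductive ArithRel : ℕ → Type
  | le : ArithRel 2

/-- The first-order language of arithmetic `0, S, +, ·, ≤`. -/
def arith : FirstOrder.Language.{0, 0} where
  Functions := ArithFunc
  Relations := ArithRel

/-- The standard model. -/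
instance : arith.Structure ℕ where
  funMap := fun {_} f => match f with
    | ArithFunc.zero => fun _ => 0
    | ArithFunc.succ => fun v => v 0 + 1
    | ArithFunc.add => fun v => v 0 + v 1
    | ArithFunc.mul => fun v => v 0 * v 1
  RelMap := fun {_} r => match r with
    | ArithRel.le => fun v => v 0 ≤ v 1

section Terms

variable {β : Type}

/-- The term `0`. -/
def tZero : arith.Term β := Constants.term (L := arith) ArithFunc.zero

/-- The term `S t`. -/
def tSucc (t : arith.Term β) : arith.Term β := Functions.apply₁ (L := arith) ArithFunc.succ t

/-- The term `s + t`. -/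
def tAdd (s t : arith.Term β) : arith.Term β := Functions.apply₂ (L := arith) ArithFunc.add s t

/-- The term `s · t`. -/
def tMul (s t : arith.Term β) : arith.Term β := Functions.apply₂ (L := arith) ArithFunc.mul s t

/-- The numeral `S(S(…S(0)…))` denoting `m`. -/
def numeral : ℕ → arith.Term β
  | 0 => tZero
  | m + 1 => tSucc (numeral m)

end Terms

section Formulas

variable {α : Type} {n : ℕ}

/-- The formula `s ≤ t`. -/
def fLe (s t : arith.Term (α ⊕ Fin n)) : arith.BoundedFormula α n :=
  Relations.boundedFormula₂ (L := arith) ArithRel.le s t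

/-- The formula `s < t`, that is, `S s ≤ t`. -/
def fLt (s t : arith.Term (α ⊕ Fin n)) : arith.BoundedFormula α n := fLe (tSucc s) t

/-- The formula `s = t`. -/
def fEq (s t : arith.Term (α ⊕ Fin n)) : arith.BoundedFormula α n := Term.bdEqual s t

/-- The formula `U(s, t)`, where `U` is a formula with two free variables. -/
def app₂ (U : arith.Formula (Fin 2)) (s t : arith.Term (α ⊕ Fin n)) : arith.BoundedFormula α n :=
  BoundedFormula.relabel (n := n) (k := 0) id
    (BoundedFormula.subst U (![s, t] : Fin 2 → arith.Term (α ⊕ Fin n)))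

/-- A term regarded as a term in one more bound variable (in which it does not occur). -/
def liftTerm (t : arith.Term (α ⊕ Fin n)) : arith.Term (α ⊕ Fin (n + 1)) :=
  t.relabel (Sum.map id Fin.castSucc)

/-- Bounded formulas (`Δ₀`): all quantifiers are of the form `∀ y ≤ t` or `∃ y ≤ t`, where `y` does
not occur in the term `t`. -/
inductive IsDelta0 : ∀ {n : ℕ}, arith.BoundedFormula α n → Prop
  | falsum {n : ℕ} : IsDelta0 (BoundedFormula.falsum (n := n))
  | equal {n : ℕ} (s t : arith.Term (α ⊕ Fin n)) : IsDelta0 (BoundedFormula.equal s t)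
  | rel {n l : ℕ} (R : arith.Relations l) (ts : Fin l → arith.Term (α ⊕ Fin n)) :
      IsDelta0 (BoundedFormula.rel R ts)
  | imp {n : ℕ} {φ ψ : arith.BoundedFormula α n} :
      IsDelta0 φ → IsDelta0 ψ → IsDelta0 (φ.imp ψ)
  | ball {n : ℕ} (t : arith.Term (α ⊕ Fin n)) {φ : arith.BoundedFormula α (n + 1)} :
      IsDelta0 φ → IsDelta0 (∀' (fLe (&(Fin.last n)) (liftTerm t) ⟹ φ))
  | bex {n : ℕ} (t : arith.Term (α ⊕ Fin n)) {φ : arith.BoundedFormula α (n + 1)} :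
      IsDelta0 φ → IsDelta0 (∃' (fLe (&(Fin.last n)) (liftTerm t) ⊓ φ))

/-- Existential (`Σ₁`) formulas: a block of existential quantifiers before a bounded formula. -/
inductive IsSigma1 : ∀ {n : ℕ}, arith.BoundedFormula α n → Prop
  | of_delta0 {n : ℕ} {φ : arith.BoundedFormula α n} : IsDelta0 φ → IsSigma1 φ
  | ex {n : ℕ} {φ : arith.BoundedFormula α (n + 1)} : IsSigma1 φ → IsSigma1 (∃' φ)

/-- Universal (`Π₁`) formulas: a block of universal quantifiers before a bounded formula. -/
inductive IsPi1 : ∀ {n : ℕ}, arith.BoundedFormula α n → Prop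
  | of_delta0 {n : ℕ} {φ : arith.BoundedFormula α n} : IsDelta0 φ → IsPi1 φ
  | all {n : ℕ} {φ : arith.BoundedFormula α (n + 1)} : IsPi1 φ → IsPi1 (∀' φ)

end Formulas

/-- The instance of induction for the formula `φ(x₀, …, x_{n-1}, y)`, where `y` is the last variable:
`∀ x₀ … x_{n-1}, (∀ z, z = 0 → φ(x, z)) → (∀ y, φ(x, y) → ∀ z, z = S y → φ(x, z)) → ∀ y, φ(x, y)`.
In the second occurrence of `φ` in the induction step the last variable is the `z` with index
`n + 1` (and not the `y` with index `n`). -/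
def inductionAxiom {n : ℕ} (φ : arith.BoundedFormula Empty (n + 1)) : arith.Sentence :=
  BoundedFormula.alls (n := n)
    ((∀' (fEq (&(Fin.last n)) tZero ⟹ φ)) ⟹
      (∀' (φ ⟹
        ∀' (fEq (&(Fin.last (n + 1))) (tSucc (&((Fin.last n).castSucc))) ⟹ φ.liftAt 1 n))) ⟹
      ∀' φ)

/-- The axioms of (first-order) Peano arithmetic. -/
inductive IsPeanoAxiom : arith.Sentence → Prop
  | succ_ne_zero : IsPeanoAxiom (∀' ∼(fEq (tSucc (&0)) tZero))
  | succ_inj : IsPeanoAxiom (∀' ∀' (fEq (tSucc (&0)) (tSucc (&1)) ⟹ fEq (&0) (&1)))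
  | add_zero : IsPeanoAxiom (∀' fEq (tAdd (&0) tZero) (&0))
  | add_succ : IsPeanoAxiom (∀' ∀' fEq (tAdd (&0) (tSucc (&1))) (tSucc (tAdd (&0) (&1))))
  | mul_zero : IsPeanoAxiom (∀' fEq (tMul (&0) tZero) tZero)
  | mul_succ : IsPeanoAxiom (∀' ∀' fEq (tMul (&0) (tSucc (&1))) (tAdd (tMul (&0) (&1)) (&0)))
  | le_iff : IsPeanoAxiom (∀' ∀' (fLe (&0) (&1) ⇔ ∃' fEq (tAdd (&0) (&2)) (&1)))
  | induction {n : ℕ} (φ : arith.BoundedFormula Empty (n + 1)) : IsPeanoAxiom (inductionAxiom φ)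

/-- Formal arithmetic (Peano arithmetic). -/
def PA : arith.Theory := {σ | IsPeanoAxiom σ}

/-- The set of all universal sentences that are true in the standard model. -/
def trueUniversal : arith.Theory := {σ | IsPi1 σ ∧ Sentence.Realize ℕ σ}

/-- Two systems of axioms have the same theorems. -/
def SameTheorems (S T : arith.Theory) : Prop := ∀ σ : arith.Sentence, S ⊨ᵇ σ ↔ T ⊨ᵇ σ

/-! ### Binary strings in arithmetic

A binary string `s` is represented by the number `m` such that `m + 1` has the binary expansion
`1s`. This is a bijection between strings and natural numbers; the strings of length less than `k`
correspond to the numbers `m` with `m + 1 < 2 ^ k`. -/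

/-- The number that represents a binary string. -/
def strCode (s : List Bool) : ℕ := s.foldl (fun m b => 2 * m + 1 + b.toNat) 0

section Strings

variable {α : Type} {n : ℕ}

/-- `P` is a power of two: every divisor `d` of `P` is `1` or even. -/
def isPowTwo (P : arith.Term (α ⊕ Fin n)) : arith.BoundedFormula α n :=
  ∀' ∀' (fEq (tMul (&((Fin.last n).castSucc)) (&(Fin.last (n + 1)))) (liftTerm (liftTerm P)) ⟹
    (fEq (&((Fin.last n).castSucc)) (numeral 1) ⊔
      ∃' fEq (&((Fin.last n).castSucc.castSucc))
        (tAdd (&(Fin.last (n + 2))) (&(Fin.last (n + 2))))))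

/-- `|q| ≤ |p| + c`, where `|·|` is the length of the string: `q + 1 < 2 ^ c * P` for every power of
two `P` such that `p + 1 < P`. -/
def lenLeAdd (c : ℕ) (q p : arith.Term (α ⊕ Fin n)) : arith.BoundedFormula α n :=
  ∀' (isPowTwo (&(Fin.last n)) ⟹ fLt (tSucc (liftTerm p)) (&(Fin.last n)) ⟹
    fLt (tSucc (liftTerm q)) (tMul (numeral (2 ^ c)) (&(Fin.last n))))

/-- The string `p` is a prefix of the string `q`: `q + 1 = (p + 1) * P + r` for some power of two `P`
and some `r < P`. -/
def isPrefix (p q : arith.Term (α ⊕ Fin n)) : arith.BoundedFormula α n :=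
  ∃' (isPowTwo (&(Fin.last n)) ⊓ ∃' (fLt (&(Fin.last (n + 1))) (&((Fin.last n).castSucc)) ⊓
    fEq (tSucc (liftTerm (liftTerm q)))
      (tAdd (tMul (tSucc (liftTerm (liftTerm p))) (&((Fin.last n).castSucc)))
        (&(Fin.last (n + 1))))))

end Strings

/-! ### Programming languages and Kolmogorov complexity -/

/-- A programming language, formally represented in arithmetic: an existential formula `U(p, x)`
(“the program `p` terminates with output `x`”; `p` and `x` are strings) such that arithmetic proves
that every program has at most one output. -/
structure IsLanguage (U : arith.Formula (Fin 2)) : Prop where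
  sigma1 : IsSigma1 U
  functional : PA ⊨ᵇ (∀' ∀' ∀' (app₂ U (&0) (&1) ⟹ app₂ U (&0) (&2) ⟹ fEq (&1) (&2)) :
    arith.Sentence)

/-- A programming language is (provably) prefix-free if no program that terminates is a proper prefix
of another one. -/
structure IsPrefixLanguage (U : arith.Formula (Fin 2)) : Prop extends IsLanguage U where
  prefixFree : PA ⊨ᵇ (∀' ∀' ∀' ∀' (app₂ U (&0) (&2) ⟹ app₂ U (&1) (&3) ⟹
    isPrefix (&0) (&1) ⟹ fEq (&0) (&1)) : arith.Sentence)

/-- The complexity with respect to `U` is (provably) at most the complexity with respect to `V` plus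
the constant `c`: for every `V`-program `p` of `x` there is a `U`-program of `x` of length at most
`|p| + c`. -/
def ComplexityLeAdd (U V : arith.Formula (Fin 2)) (c : ℕ) : Prop :=
  PA ⊨ᵇ (∀' ∀' (app₂ V (&0) (&1) ⟹ ∃' (lenLeAdd c (&2) (&0) ⊓ app₂ U (&2) (&1))) :
    arith.Sentence)

/-- `U` is an optimal programming language: it makes the complexity minimal up to an additive
constant. The complexity with respect to `U` is plain Kolmogorov complexity. -/
structure IsOptimalPlain (U : arith.Formula (Fin 2)) : Prop extends IsLanguage U where
  optimal : ∀ V, IsLanguage V → ∃ c, ComplexityLeAdd U V c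

/-- `U` is optimal among the prefix-free programming languages. The complexity with respect to `U` is
prefix Kolmogorov complexity. -/
structure IsOptimalPrefix (U : arith.Formula (Fin 2)) : Prop extends IsPrefixLanguage U where
  optimal : ∀ V, IsPrefixLanguage V → ∃ c, ComplexityLeAdd U V c

/-- In the standard model the program `p` has the output `x`. -/
def Outputs (U : arith.Formula (Fin 2)) (p x : List Bool) : Prop :=
  U.Realize (M := ℕ) ![strCode p, strCode x]

/-- The (true) Kolmogorov complexity of `x` with respect to `U`: the minimal length of a program that
outputs `x`. -/
noncomputable def complexity (U : arith.Formula (Fin 2)) (x : List Bool) : ℕ :=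
  sInf {k | ∃ p : List Bool, p.length = k ∧ Outputs U p x}

/-- The sentence `K(x) < k`: some program of length less than `k` outputs `x`. -/
def sentKLt (U : arith.Formula (Fin 2)) (x : List Bool) (k : ℕ) : arith.Sentence :=
  ∃' (fLt (tSucc (&0)) (numeral (2 ^ k)) ⊓ app₂ U (&0) (numeral (strCode x)))

/-- The sentence `K(x) ≤ k`. -/
def sentKLe (U : arith.Formula (Fin 2)) (x : List Bool) (k : ℕ) : arith.Sentence :=
  sentKLt U x (k + 1)

/-- The sentence `K(x) > k`. -/
def sentKGt (U : arith.Formula (Fin 2)) (x : List Bool) (k : ℕ) : arith.Sentence :=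
  ∼(sentKLe U x k)

/-- The sentence `K(x) = k`. -/
def sentKEq (U : arith.Formula (Fin 2)) (x : List Bool) (k : ℕ) : arith.Sentence :=
  sentKLe U x k ⊓ ∼(sentKLt U x k)

/-- Full information about complexities: for each string `x` the axiom `K(x) = k`, where `k` is the
complexity of `x`. -/
def exactAxioms (U : arith.Formula (Fin 2)) : arith.Theory :=
  {σ | ∃ x : List Bool, σ = sentKEq U x (complexity U x)}

/-- The axioms `K(x) > c x` for all strings `x` of positive complexity. As `K(x)` is an integer,
`K(x) > c x` is written as `K(x) > ⌊c x⌋`. -/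
def lowerBoundAxioms (U : arith.Formula (Fin 2)) (c : List Bool → ℝ) : arith.Theory :=
  {σ | ∃ x : List Bool, 0 < complexity U x ∧ σ = sentKGt U x ⌊c x⌋₊}

end KolmogorovArithmetic

open KolmogorovArithmetic

/-!
In a model `M` of arithmetic in which every existential sentence that holds is true, the complexity
sentences have their true values. Otherwise let `t` be the least witness in `M` of a false
existential sentence. As `t` is nonstandard, every computation that terminates in `ℕ` terminates
within time `t` in `M`. In the language behind Berry's paradox, the program `2 ^ n` outputs the
least string `x` that no program `q ≤ 2 ^ (n * e)` outputs within time `t`. This string is standard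
and its true complexity is at least `n * e`, whereas in `M` it has complexity at most `n + O(1)`.
Hence `M` satisfies no system of true lower bounds for the complexity that is within a constant
factor of optimal.
-/

namespace KolmogorovArithmetic

open FirstOrder FirstOrder.Language Set

section Semantics

section Structure

variable {N : Type} [arith.Structure N] {α : Type}

theorem realize_tZero_eq_funMap (v : α → N) :
    (tZero : arith.Term α).realize v = Structure.funMap (L := arith) ArithFunc.zero ![] :=
  congrArg (Structure.funMap (L := arith) ArithFunc.zero) (Subsingleton.elim _ _)

theorem realize_tSucc_eq_funMap (t : arith.Term α) (v : α → N) :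
    (tSucc t).realize v = Structure.funMap (L := arith) ArithFunc.succ ![t.realize v] :=
  Term.realize_functions_apply₁

theorem realize_tAdd_eq_funMap (s t : arith.Term α) (v : α → N) :
    (tAdd s t).realize v =
      Structure.funMap (L := arith) ArithFunc.add ![s.realize v, t.realize v] :=
  Term.realize_functions_apply₂

end Structure

/-- A structure for the language of arithmetic whose symbols `0`, `S`, `+`, `·`, `≤` are interpreted
by the operations and the order of the carrier, with `S a = a + 1`. -/
class CompatibleArith (N : Type) [Zero N] [One N] [Add N] [Mul N] [LE N] extends
    arith.Structure N where
  funMap_zero : funMap ArithFunc.zero ![] = (0 : N)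
  funMap_succ (a : N) : funMap ArithFunc.succ ![a] = a + 1
  funMap_add (a b : N) : funMap ArithFunc.add ![a, b] = a + b
  funMap_mul (a b : N) : funMap ArithFunc.mul ![a, b] = a * b
  relMap_le (a b : N) : RelMap ArithRel.le ![a, b] ↔ a ≤ b

variable {N : Type} [Zero N] [One N] [Add N] [Mul N] [LE N] [CompatibleArith N]
  {α : Type} {n : ℕ}

@[simp]
theorem realize_tZero (v : α → N) : (tZero : arith.Term α).realize v = 0 :=
  (realize_tZero_eq_funMap v).trans CompatibleArith.funMap_zero

@[simp]
theorem realize_tSucc (t : arith.Term α) (v : α → N) :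
    (tSucc t).realize v = t.realize v + 1 :=
  (realize_tSucc_eq_funMap t v).trans (CompatibleArith.funMap_succ _)

@[simp]
theorem realize_tAdd (s t : arith.Term α) (v : α → N) :
    (tAdd s t).realize v = s.realize v + t.realize v :=
  (realize_tAdd_eq_funMap s t v).trans (CompatibleArith.funMap_add _ _)

@[simp]
theorem realize_tMul (s t : arith.Term α) (v : α → N) :
    (tMul s t).realize v = s.realize v * t.realize v :=
  Term.realize_functions_apply₂.trans (CompatibleArith.funMap_mul _ _)

@[simp]
theorem realize_fLe (s t : arith.Term (α ⊕ Fin n)) (v : α → N) (xs : Fin n → N) :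
    (fLe s t).Realize v xs ↔ s.realize (Sum.elim v xs) ≤ t.realize (Sum.elim v xs) :=
  BoundedFormula.realize_rel₂.trans (CompatibleArith.relMap_le _ _)

@[simp]
theorem realize_fLt (s t : arith.Term (α ⊕ Fin n)) (v : α → N) (xs : Fin n → N) :
    (fLt s t).Realize v xs ↔ s.realize (Sum.elim v xs) + 1 ≤ t.realize (Sum.elim v xs) := by
  rw [fLt, realize_fLe, realize_tSucc]

end Semantics

section Substitution

variable {N : Type} [arith.Structure N] {α β : Type} {n m : ℕ}

@[simp]
theorem realize_fEq (s t : arith.Term (α ⊕ Fin n)) (v : α → N) (xs : Fin n → N) :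
    (fEq s t).Realize v xs ↔ s.realize (Sum.elim v xs) = t.realize (Sum.elim v xs) :=
  Iff.rfl

@[simp]
theorem realize_app₂ (U : arith.Formula (Fin 2)) (s t : arith.Term (α ⊕ Fin n)) (v : α → N)
    (xs : Fin n → N) :
    (app₂ U s t).Realize v xs ↔
      U.Realize ![s.realize (Sum.elim v xs), t.realize (Sum.elim v xs)] := by
  rw [app₂, BoundedFormula.realize_relabel, BoundedFormula.realize_subst, Formula.Realize,
    iff_iff_eq]
  congr 1
  · funext i
    fin_cases i <;> rfl
  · exact Subsingleton.elim _ _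

@[simp]
theorem realize_liftTerm (t : arith.Term (α ⊕ Fin n)) (v : α → N) (xs : Fin n → N) (a : N) :
    (liftTerm t).realize (Sum.elim v (Fin.snoc xs a : Fin (n + 1) → N)) =
      t.realize (Sum.elim v xs) := by
  rw [liftTerm, Term.realize_relabel, Sum.elim_comp_map, Function.comp_id]
  congr 2
  exact Fin.init_snoc (α := fun _ => N) a xs

theorem realize_comp_liftTerm (v : α → N) (xs : Fin n → N) (a : N) :
    Term.realize (L := arith) (Sum.elim v (Fin.snoc xs a : Fin (n + 1) → N)) ∘ liftTerm =
      Term.realize (Sum.elim v xs) :=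
  funext fun t => realize_liftTerm t v xs a

theorem realize_liftAt_snoc (φ : arith.BoundedFormula α (n + 1)) (v : α → N) (xs : Fin n → N)
    (y z : N) :
    (φ.liftAt 1 n).Realize v
      (Fin.snoc (Fin.snoc xs y : Fin (n + 1) → N) z : Fin (n + 2) → N) ↔
    φ.Realize v (Fin.snoc xs z : Fin (n + 1) → N) := by
  rw [BoundedFormula.realize_liftAt_one (Nat.le_succ n), iff_iff_eq]
  congr 1
  funext i
  cases i using Fin.lastCases with
  | last =>
    simp only [Function.comp_apply, Fin.val_last, lt_irrefl, if_false, Fin.succ_last,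
      Fin.snoc_last]
  | cast i => simp

/-- The simultaneous substitution of the terms `f` for the free variables and `g` for the de Bruijn
variables of a formula. (`BoundedFormula.subst` only replaces the free variables.) -/
def substAll {n m : ℕ} (f : α → arith.Term (β ⊕ Fin m)) (g : Fin n → arith.Term (β ⊕ Fin m)) :
    arith.BoundedFormula α n → arith.BoundedFormula β m
  | .falsum => .falsum
  | .equal s t => .equal (s.subst (Sum.elim f g)) (t.subst (Sum.elim f g))
  | .rel R ts => .rel R fun i => (ts i).subst (Sum.elim f g)
  | .imp φ ψ => .imp (substAll f g φ) (substAll f g ψ)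
  | .all φ => .all (substAll (liftTerm ∘ f) (Fin.snoc (liftTerm ∘ g) (&(Fin.last m))) φ)

theorem realize_subst_elim (t : arith.Term (α ⊕ Fin n)) (f : α → arith.Term β)
    (g : Fin n → arith.Term β) (w : β → N) :
    (t.subst (Sum.elim f g)).realize w =
      t.realize (Sum.elim (Term.realize w ∘ f) (Term.realize w ∘ g)) := by
  rw [Term.realize_subst, ← Sum.comp_elim]
  rfl

@[simp]
theorem realize_substAll {φ : arith.BoundedFormula α n} (f : α → arith.Term (β ⊕ Fin m))
    (g : Fin n → arith.Term (β ⊕ Fin m)) (v : β → N) (xs : Fin m → N) :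
    (substAll f g φ).Realize v xs ↔
      φ.Realize (Term.realize (Sum.elim v xs) ∘ f) (Term.realize (Sum.elim v xs) ∘ g) := by
  induction φ generalizing m with
  | falsum => rfl
  | equal s t => simp only [substAll, BoundedFormula.Realize, realize_subst_elim]
  | rel R ts => simp only [substAll, BoundedFormula.Realize, realize_subst_elim]
  | imp _ _ ih₁ ih₂ => simp only [substAll, BoundedFormula.Realize, ih₁, ih₂]
  | all _ ih =>
    simp only [substAll, BoundedFormula.Realize, ih, Fin.comp_snoc, ← Function.comp_assoc,
      realize_comp_liftTerm, Term.realize_var, Sum.elim_inr, Function.comp_apply, Fin.snoc_last]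

theorem realize_substAll_vec₁ (φ : arith.BoundedFormula Empty 1)
    (t : arith.Term (β ⊕ Fin m)) (v : β → N) (xs : Fin m → N) :
    (substAll Empty.elim ![t] φ).Realize v xs ↔
      φ.Realize default ![t.realize (Sum.elim v xs)] := by
  rw [realize_substAll, ← FinVec.map_eq _ ![t], Unique.eq_default (Term.realize _ ∘ _)]
  rfl

theorem realize_substAll_vec₂ (φ : arith.BoundedFormula (Fin 2) 1)
    (q x t : arith.Term (β ⊕ Fin m)) (v : β → N) (xs : Fin m → N) :
    (substAll ![q, x] ![t] φ).Realize v xs ↔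
      φ.Realize ![q.realize (Sum.elim v xs), x.realize (Sum.elim v xs)]
        ![t.realize (Sum.elim v xs)] := by
  rw [realize_substAll, ← FinVec.map_eq _ ![t], ← FinVec.map_eq _ ![q, x] ]
  rfl

theorem liftTerm_subst (t : arith.Term (α ⊕ Fin n)) (f : α → arith.Term (β ⊕ Fin m))
    (g : Fin n → arith.Term (β ⊕ Fin m)) :
    (liftTerm t).subst (Sum.elim (liftTerm ∘ f) (Fin.snoc (liftTerm ∘ g) (&(Fin.last m)))) =
      liftTerm (t.subst (Sum.elim f g)) := by
  induction t with
  | var i => cases i <;> simp [liftTerm, Term.relabel, Term.subst]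
  | func F ts ih => exact congrArg (Term.func F) (funext ih)

theorem substAll_fLe (s t : arith.Term (α ⊕ Fin n)) (f : α → arith.Term (β ⊕ Fin m))
    (g : Fin n → arith.Term (β ⊕ Fin m)) :
    substAll f g (fLe s t) = fLe (s.subst (Sum.elim f g)) (t.subst (Sum.elim f g)) := by
  refine congrArg (BoundedFormula.rel _) (funext fun i => ?_)
  fin_cases i <;> rfl

theorem substAll_fLe_liftTerm (t : arith.Term (α ⊕ Fin n)) (f : α → arith.Term (β ⊕ Fin m))
    (g : Fin n → arith.Term (β ⊕ Fin m)) :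
    substAll (liftTerm ∘ f) (Fin.snoc (liftTerm ∘ g) (&(Fin.last m)))
        (fLe (&(Fin.last n)) (liftTerm t)) =
      fLe (&(Fin.last m)) (liftTerm (t.subst (Sum.elim f g))) := by
  rw [substAll_fLe, liftTerm_subst]
  exact congrArg (fLe · _) (Fin.snoc_last (α := fun _ => arith.Term (β ⊕ Fin (m + 1))) _ _)

end Substitution

section Delta0

variable {α β : Type} {n m : ℕ}

theorem IsDelta0.not {φ : arith.BoundedFormula α n} (h : IsDelta0 φ) : IsDelta0 (∼φ) :=
  h.imp .falsum

theorem IsDelta0.inf {φ ψ : arith.BoundedFormula α n} (hφ : IsDelta0 φ) (hψ : IsDelta0 ψ) :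
    IsDelta0 (φ ⊓ ψ) :=
  (hφ.imp hψ.not).not

theorem IsDelta0.sup {φ ψ : arith.BoundedFormula α n} (hφ : IsDelta0 φ) (hψ : IsDelta0 ψ) :
    IsDelta0 (φ ⊔ ψ) :=
  hφ.not.imp hψ

theorem isDelta0_fLe (s t : arith.Term (α ⊕ Fin n)) : IsDelta0 (fLe s t) := .rel _ _

theorem isDelta0_fEq (s t : arith.Term (α ⊕ Fin n)) : IsDelta0 (fEq s t) := .equal _ _

theorem IsDelta0.substAll {φ : arith.BoundedFormula α n} (h : IsDelta0 φ)
    (f : α → arith.Term (β ⊕ Fin m)) (g : Fin n → arith.Term (β ⊕ Fin m)) :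
    IsDelta0 (substAll f g φ) := by
  induction h generalizing m with
  | falsum => exact .falsum
  | equal s t => exact .equal _ _
  | rel R ts => exact .rel _ _
  | imp _ _ ih₁ ih₂ => exact (ih₁ f g).imp (ih₂ f g)
  | ball t _ ih =>
    have h := IsDelta0.ball (t.subst (Sum.elim f g))
      (ih (liftTerm ∘ f) (Fin.snoc (liftTerm ∘ g) (&(Fin.last m))))
    rwa [← substAll_fLe_liftTerm] at h
  | bex t _ ih =>
    have h := IsDelta0.bex (t.subst (Sum.elim f g))
      (ih (liftTerm ∘ f) (Fin.snoc (liftTerm ∘ g) (&(Fin.last m))))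
    rwa [← substAll_fLe_liftTerm] at h

theorem IsPi1.exists_not {φ : arith.BoundedFormula α n} (h : IsPi1 φ) :
    ∃ ψ : arith.BoundedFormula α n, IsSigma1 ψ ∧
      ∀ (N : Type) [arith.Structure N] (v : α → N) (xs : Fin n → N),
        ψ.Realize v xs ↔ ¬ φ.Realize v xs := by
  induction h with
  | of_delta0 h => exact ⟨_, .of_delta0 h.not, fun N _ v xs => BoundedFormula.realize_not⟩
  | all _ ih =>
    obtain ⟨ψ, hψ, hiff⟩ := ih
    refine ⟨_, hψ.ex, fun N _ v xs => ?_⟩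
    simp only [BoundedFormula.realize_ex, BoundedFormula.realize_all, hiff, not_forall]

theorem IsSigma1.exists_not {φ : arith.BoundedFormula α n} (h : IsSigma1 φ) :
    ∃ ψ : arith.BoundedFormula α n, IsPi1 ψ ∧
      ∀ (N : Type) [arith.Structure N] (v : α → N) (xs : Fin n → N),
        ψ.Realize v xs ↔ ¬ φ.Realize v xs := by
  induction h with
  | of_delta0 h => exact ⟨_, .of_delta0 h.not, fun N _ v xs => BoundedFormula.realize_not⟩
  | ex _ ih =>
    obtain ⟨ψ, hψ, hiff⟩ := ih
    refine ⟨_, hψ.all, fun N _ v xs => ?_⟩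
    simp only [BoundedFormula.realize_ex, BoundedFormula.realize_all, hiff, not_exists]

end Delta0

namespace CompatibleArith

variable {M : Type}

section Laws

variable [Zero M] [One M] [Add M] [Mul M] [LE M] [CompatibleArith M]

theorem realize_inductionAxiom {n : ℕ} (φ : arith.BoundedFormula Empty (n + 1)) :
    M ⊨ inductionAxiom φ ↔ ∀ xs : Fin n → M,
      φ.Realize default (Fin.snoc xs 0 : Fin (n + 1) → M) →
      (∀ y, φ.Realize default (Fin.snoc xs y : Fin (n + 1) → M) →
        φ.Realize default (Fin.snoc xs (y + 1) : Fin (n + 1) → M)) →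
      ∀ y, φ.Realize default (Fin.snoc xs y : Fin (n + 1) → M) := by
  rw [inductionAxiom, Sentence.Realize, BoundedFormula.realize_alls]
  simp only [BoundedFormula.realize_imp, BoundedFormula.realize_all, realize_fEq,
    Function.comp_apply, Term.realize_var, Sum.elim_inr, Fin.snoc_last, Fin.snoc_castSucc,
    realize_tZero, realize_tSucc, realize_liftAt_snoc, forall_eq]

variable [M ⊨ PA]

theorem realize_of_isPeanoAxiom {σ : arith.Sentence} (h : IsPeanoAxiom σ) : M ⊨ σ :=
  Theory.realize_sentence_of_mem PA (show σ ∈ PA from h)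

theorem induction_of_formula {n : ℕ} (φ : arith.BoundedFormula Empty (n + 1)) (xs : Fin n → M)
    {p : M → Prop}
    (realize : ∀ y, φ.Realize default (Fin.snoc xs y : Fin (n + 1) → M) ↔ p y)
    (zero : p 0) (succ : ∀ y, p y → p (y + 1)) (y : M) : p y := by
  have ind := (realize_inductionAxiom φ).1
    (realize_of_isPeanoAxiom (IsPeanoAxiom.induction φ)) xs
  simp only [realize] at ind
  exact ind zero succ y

theorem add_one_ne_zero : ∀ a : M, a + 1 ≠ 0 := by
  simpa [Sentence.Realize, Formula.Realize, Fin.snoc] using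
    realize_of_isPeanoAxiom (M := M) .succ_ne_zero

theorem add_one_inj : ∀ a b : M, a + 1 = b + 1 → a = b := by
  simpa [Sentence.Realize, Formula.Realize, Fin.snoc] using
    realize_of_isPeanoAxiom (M := M) .succ_inj

theorem add_zero : ∀ a : M, a + 0 = a := by
  simpa [Sentence.Realize, Formula.Realize, Fin.snoc] using
    realize_of_isPeanoAxiom (M := M) .add_zero

theorem add_add_one : ∀ a b : M, a + (b + 1) = a + b + 1 := by
  simpa [Sentence.Realize, Formula.Realize, Fin.snoc] using
    realize_of_isPeanoAxiom (M := M) .add_succ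

theorem mul_zero : ∀ a : M, a * 0 = 0 := by
  simpa [Sentence.Realize, Formula.Realize, Fin.snoc] using
    realize_of_isPeanoAxiom (M := M) .mul_zero

theorem mul_add_one : ∀ a b : M, a * (b + 1) = a * b + a := by
  simpa [Sentence.Realize, Formula.Realize, Fin.snoc] using
    realize_of_isPeanoAxiom (M := M) .mul_succ

theorem le_iff_exists_add : ∀ a b : M, a ≤ b ↔ ∃ c, a + c = b := by
  simpa [Sentence.Realize, Formula.Realize, Fin.snoc] using
    realize_of_isPeanoAxiom (M := M) .le_iff

theorem zero_add (a : M) : 0 + a = a := by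
  induction a using induction_of_formula (fEq (tAdd tZero (&0)) (&0)) (![] : Fin 0 → M) with
  | realize y => simp
  | zero => rw [add_zero]
  | succ y h => rw [add_add_one, h]

theorem add_one_add (a b : M) : a + 1 + b = a + b + 1 := by
  induction b using induction_of_formula
    (fEq (tAdd (tSucc (&0)) (&1)) (tSucc (tAdd (&0) (&1)))) ![a] with
  | realize y => simp
  | zero => rw [add_zero, add_zero]
  | succ y h => rw [add_add_one, h, add_add_one]

theorem add_comm (a b : M) : a + b = b + a := by
  induction b using induction_of_formula (fEq (tAdd (&0) (&1)) (tAdd (&1) (&0))) ![a] with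
  | realize y => simp
  | zero => rw [add_zero, zero_add]
  | succ y h => rw [add_add_one, h, add_one_add]

theorem add_assoc (a b c : M) : a + b + c = a + (b + c) := by
  induction c using induction_of_formula
    (fEq (tAdd (tAdd (&0) (&1)) (&2)) (tAdd (&0) (tAdd (&1) (&2)))) ![a, b] with
  | realize y => simp
  | zero => rw [add_zero, add_zero]
  | succ y h => rw [add_add_one, h, add_add_one, add_add_one]

theorem add_right_cancel {a b c : M} : a + c = b + c → a = b := by
  induction c using induction_of_formula
    (fEq (tAdd (&0) (&2)) (tAdd (&1) (&2)) ⟹ fEq (&0) (&1)) ![a, b] with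
  | realize y => simp
  | zero => rw [add_zero, add_zero]; exact id
  | succ y h =>
    rw [add_add_one, add_add_one]
    exact fun e => h (add_one_inj _ _ e)

theorem zero_mul (a : M) : 0 * a = 0 := by
  induction a using induction_of_formula (fEq (tMul tZero (&0)) tZero) (![] : Fin 0 → M) with
  | realize y => simp
  | zero => rw [mul_zero]
  | succ y h => rw [mul_add_one, h, add_zero]

theorem add_one_mul (a b : M) : (a + 1) * b = a * b + b := by
  induction b using induction_of_formula
    (fEq (tMul (tSucc (&0)) (&1)) (tAdd (tMul (&0) (&1)) (&1))) ![a] with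
  | realize y => simp
  | zero => rw [mul_zero, mul_zero, add_zero]
  | succ y h =>
    rw [mul_add_one, h, mul_add_one, add_add_one, add_add_one, add_assoc (a * y), add_comm y,
      ← add_assoc]

theorem mul_comm (a b : M) : a * b = b * a := by
  induction b using induction_of_formula (fEq (tMul (&0) (&1)) (tMul (&1) (&0))) ![a] with
  | realize y => simp
  | zero => rw [mul_zero, zero_mul]
  | succ y h => rw [mul_add_one, h, add_one_mul]

theorem mul_add (a b c : M) : a * (b + c) = a * b + a * c := by
  induction c using induction_of_formula
    (fEq (tMul (&0) (tAdd (&1) (&2))) (tAdd (tMul (&0) (&1)) (tMul (&0) (&2)))) ![a, b] with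
  | realize y => simp
  | zero => rw [mul_zero, add_zero, add_zero]
  | succ y h => rw [add_add_one, mul_add_one, mul_add_one, h, add_assoc]

theorem mul_assoc (a b c : M) : a * b * c = a * (b * c) := by
  induction c using induction_of_formula
    (fEq (tMul (tMul (&0) (&1)) (&2)) (tMul (&0) (tMul (&1) (&2)))) ![a, b] with
  | realize y => simp
  | zero => rw [mul_zero, mul_zero, mul_zero]
  | succ y h => rw [mul_add_one, mul_add_one, mul_add, h]

theorem eq_zero_or_eq_add_one (a : M) : a = 0 ∨ ∃ b, a = b + 1 := by
  induction a using induction_of_formula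
    (fEq (&0) tZero ⊔ ∃' fEq (&0) (tSucc (&1))) (![] : Fin 0 → M) with
  | realize y => simp
  | zero => exact .inl rfl
  | succ y _ => exact .inr ⟨y, rfl⟩

theorem le_total (a b : M) : a ≤ b ∨ b ≤ a := by
  induction b using induction_of_formula (fLe (&0) (&1) ⊔ fLe (&1) (&0)) ![a] with
  | realize y => simp
  | zero => exact .inr ((le_iff_exists_add _ _).2 ⟨a, zero_add a⟩)
  | succ y h =>
    simp only [le_iff_exists_add] at h ⊢
    rcases h with ⟨c, rfl⟩ | ⟨c, rfl⟩
    · exact .inl ⟨c + 1, add_add_one a c⟩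
    · rcases eq_zero_or_eq_add_one c with rfl | ⟨d, rfl⟩
      · exact .inl ⟨0 + 1, by rw [add_zero, add_add_one, add_zero]⟩
      · exact .inr ⟨d, by rw [add_one_add, add_add_one]⟩

theorem le_trans {a b c : M} (hab : a ≤ b) (hbc : b ≤ c) : a ≤ c := by
  obtain ⟨d, rfl⟩ := (le_iff_exists_add a b).1 hab
  obtain ⟨e, rfl⟩ := (le_iff_exists_add _ c).1 hbc
  exact (le_iff_exists_add _ _).2 ⟨d + e, (add_assoc a d e).symm⟩

theorem le_antisymm {a b : M} (hab : a ≤ b) (hba : b ≤ a) : a = b := by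
  obtain ⟨c, rfl⟩ := (le_iff_exists_add a b).1 hab
  obtain ⟨d, hd⟩ := (le_iff_exists_add _ a).1 hba
  have hcd : c + d = 0 :=
    add_right_cancel (c := a) (by rw [add_comm, ← add_assoc, hd, zero_add])
  rcases eq_zero_or_eq_add_one c with rfl | ⟨e, rfl⟩
  · rw [add_zero]
  · exact absurd (add_one_add e d ▸ hcd) (add_one_ne_zero _)

/-- The semiring of a model of arithmetic. -/
abbrev commSemiring : CommSemiring M where
  add_assoc := add_assoc
  zero_add := zero_add
  add_zero := add_zero
  add_comm := add_comm
  mul_assoc := mul_assoc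
  mul_comm := mul_comm
  left_distrib := mul_add
  right_distrib a b c := by rw [mul_comm, mul_add, mul_comm c a, mul_comm c b]
  zero_mul := zero_mul
  mul_zero := mul_zero
  one_mul a := by rw [← zero_add 1, add_one_mul, zero_mul, zero_add]
  mul_one a := by rw [← zero_add 1, mul_add_one, mul_zero, zero_add]
  nsmul := nsmulRec

/-- The linear order of a model of arithmetic. -/
noncomputable abbrev linearOrder : LinearOrder M where
  le_refl a := (le_iff_exists_add a a).2 ⟨0, add_zero a⟩
  le_trans _ _ _ := le_trans
  le_antisymm _ _ := le_antisymm
  le_total := le_total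
  toDecidableLE := Classical.decRel _

end Laws

section OrderedSemiring

variable [CommSemiring M] [LinearOrder M] [CompatibleArith M] [M ⊨ PA]

theorem canonicallyOrderedAdd : CanonicallyOrderedAdd M where
  exists_add_of_le h := ((le_iff_exists_add _ _).1 h).imp fun _ => Eq.symm
  le_add_self a b := (le_iff_exists_add _ _).2 ⟨b, add_comm a b⟩
  le_self_add _ b := (le_iff_exists_add _ _).2 ⟨b, rfl⟩

theorem add_one_le_iff_lt {a b : M} : a + 1 ≤ b ↔ a < b := by
  rw [lt_iff_le_and_ne, le_iff_exists_add, le_iff_exists_add]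
  constructor
  · rintro ⟨c, rfl⟩
    refine ⟨⟨1 + c, (add_assoc a 1 c).symm⟩, fun h => add_one_ne_zero c ?_⟩
    exact add_right_cancel (c := a) (by rw [zero_add, add_comm, add_comm c, ← add_assoc, ← h])
  · rintro ⟨⟨c, rfl⟩, hne⟩
    rcases eq_zero_or_eq_add_one c with rfl | ⟨d, rfl⟩
    · exact absurd (add_zero a).symm hne
    · exact ⟨d, by ring⟩

theorem isStrictOrderedRing : IsStrictOrderedRing M :=
  haveI := canonicallyOrderedAdd (M := M)
  haveI : Nontrivial M := ⟨⟨0 + 1, 0, add_one_ne_zero 0⟩⟩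
  haveI : IsOrderedCancelAddMonoid M :=
    { add_le_add_left a b h c := add_le_add_left h c
      le_of_add_le_add_left a b c h := by
        obtain ⟨d, hd⟩ := exists_add_of_le h
        refine (le_iff_exists_add _ _).2 ⟨d, add_right_cancel (c := a) ?_⟩
        rw [add_comm c, hd, add_comm, add_assoc] }
  have mul_lt_mul {a b c : M} (ha : 0 < a) (h : b < c) : a * b < a * c := by
    obtain ⟨d, rfl⟩ := exists_add_of_le (add_one_le_iff_lt.2 ha)
    obtain ⟨e, rfl⟩ := exists_add_of_le (add_one_le_iff_lt.2 h)
    exact add_one_le_iff_lt.1 ((le_iff_exists_add _ _).2 ⟨d + e + d * e, by ring⟩)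
  { zero_le_one := _root_.zero_le
    mul_lt_mul_of_pos_left a ha b c h := mul_lt_mul ha h
    mul_lt_mul_of_pos_right a ha b c h := by
      simpa only [mul_comm _ a] using mul_lt_mul ha h }

end OrderedSemiring

end CompatibleArith

/-- A model of Peano arithmetic, as an ordered semiring: the symbols of the language are interpreted
by the operations of the carrier. Every model of `PA` is of this form (`PeanoModel.ofModel`). -/
class PeanoModel (M : Type) extends CommSemiring M, LinearOrder M, IsStrictOrderedRing M,
    CanonicallyOrderedAdd M, SuccAddOrder M, CompatibleArith M where
  models_PA : M ⊨ PA

attribute [instance] PeanoModel.models_PA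

section OfModel

variable {M : Type} [arith.Structure M]

theorem funMap_succ_eq_funMap_add [M ⊨ PA] (a : M) :
    Structure.funMap (L := arith) ArithFunc.succ ![a] =
      Structure.funMap (L := arith) ArithFunc.add
        ![a, Structure.funMap (L := arith) ArithFunc.succ
          ![Structure.funMap (L := arith) ArithFunc.zero ![] ] ] := by
  have add_zero : Sentence.Realize M _ := Theory.realize_sentence_of_mem PA IsPeanoAxiom.add_zero
  have add_succ : Sentence.Realize M _ := Theory.realize_sentence_of_mem PA IsPeanoAxiom.add_succ
  simp only [Sentence.Realize, Formula.Realize, BoundedFormula.realize_all, realize_fEq,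
    realize_tSucc_eq_funMap, realize_tAdd_eq_funMap, realize_tZero_eq_funMap] at add_zero add_succ
  refine .trans ?_ (add_succ a _).symm
  exact congrArg (fun b => Structure.funMap (L := arith) ArithFunc.succ ![b]) (add_zero a).symm

/-- A model of `PA` as an ordered semiring, where `1` is the successor of `0`. -/
noncomputable abbrev PeanoModel.ofModel (M : Type) [S : arith.Structure M] [hM : M ⊨ PA] :
    PeanoModel M :=
  letI : Zero M := ⟨Structure.funMap (L := arith) ArithFunc.zero ![]⟩
  letI : One M := ⟨Structure.funMap (L := arith) ArithFunc.succ ![0]⟩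
  letI : Add M := ⟨fun a b => Structure.funMap (L := arith) ArithFunc.add ![a, b]⟩
  letI : Mul M := ⟨fun a b => Structure.funMap (L := arith) ArithFunc.mul ![a, b]⟩
  letI : LE M := ⟨fun a b => Structure.RelMap (L := arith) ArithRel.le ![a, b]⟩
  letI : CompatibleArith M :=
    { __ := S
      funMap_zero := rfl
      funMap_succ := funMap_succ_eq_funMap_add
      funMap_add _ _ := rfl
      funMap_mul _ _ := rfl
      relMap_le _ _ := Iff.rfl }
  letI := CompatibleArith.commSemiring (M := M)
  letI := CompatibleArith.linearOrder (M := M)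
  { __ := CompatibleArith.commSemiring (M := M)
    __ := CompatibleArith.linearOrder (M := M)
    __ := CompatibleArith.canonicallyOrderedAdd (M := M)
    __ := CompatibleArith.isStrictOrderedRing (M := M)
    __ := SuccOrder.ofSuccLeIff (fun a : M => a + 1) CompatibleArith.add_one_le_iff_lt
    succ_eq_add_one _ := rfl
    __ := (inferInstance : CompatibleArith M)
    models_PA := hM }

end OfModel

instance : CompatibleArith ℕ where
  __ := (inferInstance : arith.Structure ℕ)
  funMap_zero := rfl
  funMap_succ _ := rfl
  funMap_add _ _ := rfl
  funMap_mul _ _ := rfl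
  relMap_le _ _ := Iff.rfl

theorem nat_models_PA : ℕ ⊨ PA := by
  refine ⟨fun σ hσ => ?_⟩
  cases (show IsPeanoAxiom σ from hσ) with
  | induction φ =>
    exact (CompatibleArith.realize_inductionAxiom φ).2 fun xs h0 hs y => Nat.rec h0 hs y
  | le_iff =>
    simp [Sentence.Realize, Formula.Realize, Fin.snoc, le_iff_exists_add, eq_comm]
  | _ =>
    simp [Sentence.Realize, Formula.Realize, Fin.snoc, mul_add_one, Nat.add_assoc]

instance : PeanoModel ℕ where
  __ := (inferInstance : CompatibleArith ℕ)
  models_PA := nat_models_PA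

theorem models_union_iff {T : arith.Theory} {σ : arith.Sentence} :
    PA ∪ T ⊨ᵇ σ ↔ ∀ (M : Type) [PeanoModel M], M ⊨ T → M ⊨ σ := by
  refine ⟨fun h M _ hT => ?_, fun h => Theory.models_sentence_iff.2 fun M => ?_⟩
  · have : M ⊨ PA ∪ T := PeanoModel.models_PA.union hT
    exact h.realize_sentence M
  · have : M ⊨ PA := M.is_model.mono subset_union_left
    exact @h M (PeanoModel.ofModel M) (M.is_model.mono subset_union_right)

theorem models_PA_iff {σ : arith.Sentence} :
    PA ⊨ᵇ σ ↔ ∀ (M : Type) [PeanoModel M], M ⊨ σ := by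
  rw [← union_empty PA, models_union_iff]
  exact forall₂_congr fun M _ => forall_prop_of_true (model_empty (M := M))

theorem sameTheorems_of_models {A B : arith.Theory}
    (h : ∀ (M : Type) [PeanoModel M], M ⊨ A ↔ M ⊨ B) : SameTheorems (PA ∪ A) (PA ∪ B) :=
  fun σ => by simp only [models_union_iff, h]

section DiscretelyOrderedSemiring

variable {M : Type*} [CommSemiring M] [LinearOrder M] [IsStrictOrderedRing M]
  [CanonicallyOrderedAdd M] [SuccAddOrder M]

theorem not_even_and_odd {a : M} : ¬ (Even a ∧ Odd a) := by
  rintro ⟨⟨k, rfl⟩, l, h⟩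
  rw [← two_mul] at h
  rcases le_or_gt k l with hkl | hlk
  · exact (Order.lt_add_one_iff.2 (mul_le_mul_right hkl 2)).ne h
  · refine lt_irrefl (2 * l + 1) ?_
    calc 2 * l + 1 < 2 * l + 1 + 1 := lt_add_one _
      _ = 2 * (l + 1) := by ring
      _ ≤ 2 * k := mul_le_mul_right (Order.add_one_le_iff.2 hlk) 2
      _ = 2 * l + 1 := h

theorem le_of_dvd {a b : M} (h : a ∣ b) (hb : b ≠ 0) : a ≤ b := by
  obtain ⟨c, rfl⟩ := h
  have hc : 0 < c := pos_iff_ne_zero.2 (right_ne_zero_of_mul hb)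
  exact le_mul_of_one_le_right' (Order.one_le_iff_pos.2 hc)

theorem exists_natCast_eq_of_le {a : M} {n : ℕ} (h : a ≤ n) : ∃ k ≤ n, (k : M) = a := by
  induction n with
  | zero => exact ⟨0, le_rfl, (le_antisymm h (by simp)).symm⟩
  | succ n ih =>
    rcases h.lt_or_eq with h | rfl
    · rw [Nat.cast_succ, Order.lt_add_one_iff] at h
      exact (ih h).imp fun k => And.imp_left Nat.le_succ_of_le
    · exact ⟨n + 1, le_rfl, rfl⟩

theorem finite_Iic_natCast (n : ℕ) : (Set.Iic (n : M)).Finite :=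
  ((Set.finite_Iic n).image (Nat.cast : ℕ → M)).subset fun _ h => exists_natCast_eq_of_le h

theorem exists_isLeast_natCast {S : Set M} {n : ℕ} (hn : (n : M) ∈ S) :
    ∃ m : ℕ, IsLeast S (m : M) := by
  classical
  have hex : ∃ m : ℕ, (m : M) ∈ S := ⟨n, hn⟩
  refine ⟨Nat.find hex, Nat.find_spec hex, fun b hb => ?_⟩
  by_contra! hlt
  obtain ⟨k, -, rfl⟩ := exists_natCast_eq_of_le hlt.le
  exact Nat.find_min hex (Nat.cast_lt.1 hlt) hb

theorem exists_natCast_forall_le_not {R : M → M → Prop}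
    (hR : ∀ q x y, R q x → R q y → x = y) (B : ℕ) : ∃ x : ℕ, ∀ q ≤ (B : M), ¬ R q x := by
  by_contra! hcon
  choose f hfB hf using hcon
  obtain ⟨a, -, b, -, hab, hfab⟩ :=
    infinite_univ.exists_ne_map_eq_of_mapsTo (fun x _ => hfB x) (finite_Iic_natCast B)
  exact hab (Nat.cast_injective (hR _ _ _ (hf a) (hfab ▸ hf b)))

end DiscretelyOrderedSemiring

section PeanoModel

variable {M : Type} [PeanoModel M]

@[simp]
theorem realize_numeral {α : Type} (m : ℕ) (v : α → M) : (numeral m).realize v = (m : M) := by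
  induction m with
  | zero => rw [numeral, realize_tZero, Nat.cast_zero]
  | succ m ih => rw [numeral, realize_tSucc, ih, Nat.cast_succ]

theorem exists_isLeast_of_formula {n : ℕ} (φ : arith.BoundedFormula Empty (n + 1))
    (xs : Fin n → M) {S : Set M}
    (hS : ∀ y, φ.Realize default (Fin.snoc xs y : Fin (n + 1) → M) ↔ y ∈ S)
    (hne : S.Nonempty) : ∃ a, IsLeast S a := by
  by_contra! hcon
  have key (y : M) : ∀ z ≤ y, z ∉ S := by
    induction y using CompatibleArith.induction_of_formula
      (∀' (fLe (&(Fin.last (n + 1))) (&((Fin.last n).castSucc)) ⟹ ∼(φ.liftAt 1 n))) xs with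
    | realize y =>
      simp only [BoundedFormula.realize_all, BoundedFormula.realize_imp, realize_fLe,
        BoundedFormula.realize_not, realize_liftAt_snoc, hS, Term.realize_var, Sum.elim_inr,
        Fin.snoc_last, Fin.snoc_castSucc, Function.comp_apply]
    | zero =>
      intro z hz hzS
      exact hcon z ⟨hzS, fun c _ => hz.trans zero_le⟩
    | succ y ih =>
      intro z hz hzS
      refine hcon z ⟨hzS, fun c hc => ?_⟩
      by_contra! hcz
      exact ih c (Order.lt_add_one_iff.1 (hcz.trans_le hz)) hc
  exact hne.elim fun a => key a a le_rfl

theorem even_or_odd (a : M) : Even a ∨ Odd a := by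
  induction a using CompatibleArith.induction_of_formula
    ((∃' fEq (&0) (tAdd (&1) (&1))) ⊔ ∃' fEq (&0) (tSucc (tMul (numeral 2) (&1))))
    (![] : Fin 0 → M) with
  | realize a => simp [Even, Odd]
  | zero => exact .inl .zero
  | succ a ih => exact ih.symm.imp Odd.add_one Even.add_one

/-- Powers of two, as `isPowTwo` expresses them in a model of arithmetic. -/
def IsPowTwo (P : M) : Prop := ∀ d, d ∣ P → d = 1 ∨ Even d

@[simp]
theorem realize_isPowTwo {α : Type} {n : ℕ} (P : arith.Term (α ⊕ Fin n)) (v : α → M)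
    (xs : Fin n → M) :
    (isPowTwo P).Realize v xs ↔ IsPowTwo (P.realize (Sum.elim v xs)) := by
  simp [isPowTwo, IsPowTwo, Even, Dvd.dvd, eq_comm]

namespace IsPowTwo

variable {P Q R r : M}

theorem of_dvd (hP : IsPowTwo P) (h : Q ∣ P) : IsPowTwo Q := fun d hd => hP d (hd.trans h)

theorem eq_one_or_even (hP : IsPowTwo P) : P = 1 ∨ Even P := hP P dvd_rfl

theorem ne_zero (hP : IsPowTwo P) : P ≠ 0 := by
  rintro rfl
  rcases hP (1 + 1 + 1) (dvd_zero _) with h | h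
  · simp [add_assoc] at h
  · exact not_even_and_odd ⟨h, 1, by rw [two_mul]⟩

theorem one_le (hP : IsPowTwo P) : 1 ≤ P := Order.one_le_iff_pos.2 (pos_iff_ne_zero.2 hP.ne_zero)

theorem one : IsPowTwo (1 : M) := fun _ hd =>
  .inl ((le_of_dvd hd one_ne_zero).antisymm
    (Order.one_le_iff_pos.2 (pos_iff_ne_zero.2 (ne_zero_of_dvd_ne_zero one_ne_zero hd))))

theorem two_mul (hP : IsPowTwo P) : IsPowTwo (2 * P) := by
  rintro d ⟨e, he⟩
  rcases even_or_odd d with hd | hd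
  · exact .inr hd
  rcases even_or_odd e with ⟨k, rfl⟩ | hodd
  · refine hP d ⟨k, mul_left_cancel₀ (two_ne_zero (α := M)) ?_⟩
    rw [he]; ring
  · exact absurd ⟨even_two_mul P, he ▸ hd.mul hodd⟩ not_even_and_odd

theorem two_pow (k : ℕ) : IsPowTwo (2 ^ k : M) := by
  induction k with
  | zero => rw [pow_zero]; exact .one
  | succ k ih => rw [pow_succ']; exact ih.two_mul

theorem dvd_of_le (hP : IsPowTwo P) (hQ : IsPowTwo Q) (h : Q ≤ P) : Q ∣ P := by
  by_contra hQP
  obtain ⟨P, ⟨hP, Q, hQ, h, hQP⟩, hmin⟩ := exists_isLeast_of_formula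
    (isPowTwo (&0) ⊓ ∃' (isPowTwo (&1) ⊓ (fLe (&1) (&0) ⊓ ∼(∃' fEq (&0) (tMul (&1) (&2))))))
    (![] : Fin 0 → M)
    (S := {P | IsPowTwo P ∧ ∃ Q, IsPowTwo Q ∧ Q ≤ P ∧ ¬ Q ∣ P})
    (fun P => by simp [Dvd.dvd]) ⟨P, hP, Q, hQ, h, hQP⟩
  rcases hQ.eq_one_or_even with rfl | ⟨l, rfl⟩
  · exact hQP (one_dvd P)
  rcases hP.eq_one_or_even with rfl | ⟨k, rfl⟩
  · exact hQP (h.antisymm hQ.one_le ▸ dvd_rfl)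
  rw [← _root_.two_mul, ← _root_.two_mul] at *
  have hlk : ¬ l ∣ k := fun hlk => hQP (mul_dvd_mul_left 2 hlk)
  have hk : k + k ≤ k := by
    rw [← _root_.two_mul]
    exact hmin ⟨hP.of_dvd (dvd_mul_left k 2), l, hQ.of_dvd (dvd_mul_left l 2),
      le_of_mul_le_mul_left h two_pos, hlk⟩
  have : k = 0 := by simpa using hk
  exact hlk (this ▸ dvd_zero l)

theorem eq_of_add_one_eq (hP : IsPowTwo P) (hQ : IsPowTwo Q) (hR : IsPowTwo R) (hP1 : P ≠ 1)
    (hr : r < R) (h : Q + 1 = (P + 1) * R + r) : P = Q := by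
  rcases eq_or_ne R 1 with rfl | hR1
  · obtain rfl : r = 0 := Order.lt_one_iff.1 hr
    simpa using h.symm
  exfalso
  have hR1 : 1 < R := hR.one_le.lt_of_ne' hR1
  have hRQ : R ≤ Q := by
    rw [← Order.lt_add_one_iff, h]
    calc R < R + R := lt_add_of_pos_right R (one_pos.trans hR1)
      _ = (1 + 1) * R := by ring
      _ ≤ (P + 1) * R := by gcongr; exact hP.one_le
      _ ≤ (P + 1) * R + r := le_self_add
  obtain ⟨S, rfl⟩ := hQ.dvd_of_le hR hRQ
  have hS : S = P + 1 := by
    refine le_antisymm (Order.lt_add_one_iff.1 ?_) (Order.add_one_le_iff.2 ?_)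
    · refine lt_of_mul_lt_mul_left (a := R) ?_ zero_le
      calc R * S < R * S + 1 := lt_add_one _
        _ = (P + 1) * R + r := h
        _ < (P + 1) * R + R := by gcongr
        _ = R * (P + 1 + 1) := by ring
    · refine lt_of_mul_lt_mul_left (a := R) (lt_of_add_lt_add_right (a := 1) ?_) zero_le
      calc R * P + 1 < R * P + R := by gcongr
        _ = (P + 1) * R := by ring
        _ ≤ (P + 1) * R + r := le_self_add
        _ = R * S + 1 := h.symm
  rcases hQ (P + 1) ⟨R, by rw [hS, mul_comm]⟩ with h1 | hodd
  · exact hP.ne_zero (by simpa using h1)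
  · exact not_even_and_odd ⟨hodd, (hP.eq_one_or_even.resolve_left hP1).add_one⟩

end IsPowTwo

end PeanoModel

section BoundedQuantifiers

variable {N : Type} [Zero N] [One N] [Add N] [Mul N] [LE N] [CompatibleArith N]
  {α : Type} {n : ℕ}

/-- The bounded quantification `∀ y ≤ t, φ(y)`. -/
def ballLe (t : arith.Term (α ⊕ Fin n)) (φ : arith.BoundedFormula α (n + 1)) :
    arith.BoundedFormula α n :=
  ∀' (fLe (&(Fin.last n)) (liftTerm t) ⟹ φ)

/-- The bounded quantification `∃ y ≤ t, φ(y)`. -/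
def bexLe (t : arith.Term (α ⊕ Fin n)) (φ : arith.BoundedFormula α (n + 1)) :
    arith.BoundedFormula α n :=
  ∃' (fLe (&(Fin.last n)) (liftTerm t) ⊓ φ)

@[simp]
theorem realize_ballLe (t : arith.Term (α ⊕ Fin n)) (φ : arith.BoundedFormula α (n + 1))
    (v : α → N) (xs : Fin n → N) :
    (ballLe t φ).Realize v xs ↔
      ∀ a ≤ t.realize (Sum.elim v xs), φ.Realize v (Fin.snoc xs a : Fin (n + 1) → N) := by
  simp only [ballLe, BoundedFormula.realize_all, BoundedFormula.realize_imp, realize_fLe,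
    realize_liftTerm, Function.comp_apply, Term.realize_var, Sum.elim_inr, Fin.snoc_last]

@[simp]
theorem realize_bexLe (t : arith.Term (α ⊕ Fin n)) (φ : arith.BoundedFormula α (n + 1))
    (v : α → N) (xs : Fin n → N) :
    (bexLe t φ).Realize v xs ↔
      ∃ a ≤ t.realize (Sum.elim v xs), φ.Realize v (Fin.snoc xs a : Fin (n + 1) → N) := by
  simp only [bexLe, BoundedFormula.realize_ex, BoundedFormula.realize_inf, realize_fLe,
    realize_liftTerm, Function.comp_apply, Term.realize_var, Sum.elim_inr, Fin.snoc_last]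

end BoundedQuantifiers

section Absoluteness

variable {N M : Type} [Zero N] [One N] [Add N] [Mul N] [LE N] [CompatibleArith N]
  [Zero M] [One M] [Add M] [Mul M] [LE M] [CompatibleArith M] {α : Type} {n : ℕ}

theorem map_le_map_iff (f : N ↪[arith] M) {a b : N} : f a ≤ f b ↔ a ≤ b :=
  calc f a ≤ f b
    _ ↔ Structure.RelMap (L := arith) ArithRel.le ![f a, f b] :=
      (CompatibleArith.relMap_le _ _).symm
    _ ↔ Structure.RelMap (L := arith) ArithRel.le (f ∘ ![a, b]) := by
      rw [← FinVec.map_eq]; rfl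
    _ ↔ Structure.RelMap (L := arith) ArithRel.le ![a, b] := f.map_rel _ _
    _ ↔ a ≤ b := CompatibleArith.relMap_le _ _

theorem IsDelta0.realize_embedding_iff {φ : arith.BoundedFormula α n} (hφ : IsDelta0 φ)
    (f : N ↪[arith] M) (hf : IsLowerSet (range f)) (v : α → N) (xs : Fin n → N) :
    φ.Realize (f ∘ v) (f ∘ xs) ↔ φ.Realize v xs := by
  induction hφ with
  | falsum => rfl
  | equal s t =>
    simp only [BoundedFormula.Realize, ← Sum.comp_elim, HomClass.realize_term,
      EmbeddingLike.apply_eq_iff_eq]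
  | rel R ts =>
    simp only [BoundedFormula.Realize, ← Sum.comp_elim, HomClass.realize_term]
    exact f.map_rel R _
  | imp _ _ ih₁ ih₂ => simp only [BoundedFormula.realize_imp, ih₁, ih₂]
  | ball t _ ih =>
    refine (realize_ballLe t _ _ _).trans (Iff.trans ?_ (realize_ballLe t _ _ _).symm)
    rw [← Sum.comp_elim, HomClass.realize_term]
    refine ⟨fun h a ha => ?_, fun h b hb => ?_⟩
    · refine (ih _).1 ?_
      rw [Fin.comp_snoc]
      exact h (f a) ((map_le_map_iff f).2 ha)
    · obtain ⟨a, rfl⟩ := hf hb (mem_range_self _)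
      rw [← Fin.comp_snoc]
      exact (ih _).2 (h a ((map_le_map_iff f).1 hb))
  | bex t _ ih =>
    refine (realize_bexLe t _ _ _).trans (Iff.trans ?_ (realize_bexLe t _ _ _).symm)
    rw [← Sum.comp_elim, HomClass.realize_term]
    refine ⟨fun ⟨b, hb, h⟩ => ?_, fun ⟨a, ha, h⟩ => ⟨f a, (map_le_map_iff f).2 ha, ?_⟩⟩
    · obtain ⟨a, rfl⟩ := hf hb (mem_range_self _)
      rw [← Fin.comp_snoc] at h
      exact ⟨a, (map_le_map_iff f).1 hb, (ih _).1 h⟩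
    · rw [← Fin.comp_snoc]
      exact (ih _).2 h

theorem IsSigma1.realize_embedding {φ : arith.BoundedFormula α n} (hφ : IsSigma1 φ)
    (f : N ↪[arith] M) (hf : IsLowerSet (range f)) {v : α → N} {xs : Fin n → N}
    (h : φ.Realize v xs) : φ.Realize (f ∘ v) (f ∘ xs) := by
  induction hφ with
  | of_delta0 hφ => exact (hφ.realize_embedding_iff f hf v xs).2 h
  | ex _ ih =>
    obtain ⟨a, ha⟩ := BoundedFormula.realize_ex.1 h
    refine BoundedFormula.realize_ex.2 ⟨f a, ?_⟩
    rw [← Fin.comp_snoc]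
    exact ih ha

end Absoluteness

section NatCast

variable (M : Type) [PeanoModel M]

/-- The standard model as the initial segment of the numerals of a model of arithmetic. -/
def natCastEmbedding : ℕ ↪[arith] M where
  toFun := Nat.cast
  inj' := Nat.cast_injective
  map_fun' F w := by
    cases F with
    | zero =>
      rw [Subsingleton.elim (Nat.cast ∘ w) ![], CompatibleArith.funMap_zero]
      exact Nat.cast_zero
    | succ =>
      rw [← FinVec.etaExpand_eq (Nat.cast ∘ w)]
      exact (Nat.cast_succ (w 0)).trans (CompatibleArith.funMap_succ _).symm
    | add =>
      rw [← FinVec.etaExpand_eq (Nat.cast ∘ w)]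
      exact (Nat.cast_add (w 0) (w 1)).trans (CompatibleArith.funMap_add _ _).symm
    | mul =>
      rw [← FinVec.etaExpand_eq (Nat.cast ∘ w)]
      exact (Nat.cast_mul (w 0) (w 1)).trans (CompatibleArith.funMap_mul _ _).symm
  map_rel' R w := by
    cases R with
    | le =>
      rw [← FinVec.etaExpand_eq (Nat.cast ∘ w)]
      exact (CompatibleArith.relMap_le _ _).trans Nat.cast_le

theorem isLowerSet_range_natCastEmbedding : IsLowerSet (range (natCastEmbedding M)) := by
  rintro _ _ h ⟨n, rfl⟩
  obtain ⟨k, -, hk⟩ := exists_natCast_eq_of_le h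
  exact ⟨k, hk⟩

variable {M} in
theorem IsDelta0.realize_natCast_iff {α : Type} {n : ℕ} {φ : arith.BoundedFormula α n}
    (hφ : IsDelta0 φ) (v : α → ℕ) (xs : Fin n → ℕ) :
    φ.Realize (Nat.cast ∘ v : α → M) (Nat.cast ∘ xs) ↔ φ.Realize v xs :=
  hφ.realize_embedding_iff (natCastEmbedding M) (isLowerSet_range_natCastEmbedding M) v xs

end NatCast

/-- `θ` is a witness form of `φ`: a bounded formula with one more variable `t`, monotone in `t`,
such that the models of arithmetic satisfy `φ ↔ ∃ t, θ(t)`. For a programming language, `θ(t)` says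
that the program terminates within time `t`. -/
structure IsWitnessForm {α : Type} {n : ℕ} (θ : arith.BoundedFormula α (n + 1))
    (φ : arith.BoundedFormula α n) : Prop where
  isDelta0 : IsDelta0 θ
  realize_iff {M : Type} [PeanoModel M] (v : α → M) (xs : Fin n → M) :
    φ.Realize v xs ↔ ∃ t, θ.Realize v (Fin.snoc xs t : Fin (n + 1) → M)
  mono {M : Type} [PeanoModel M] (v : α → M) (xs : Fin n → M) :
    Monotone fun t => θ.Realize v (Fin.snoc xs t : Fin (n + 1) → M)

theorem exists_isWitnessForm_of_isDelta0 {α : Type} {n : ℕ} {φ : arith.BoundedFormula α n}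
    (h : IsDelta0 φ) : ∃ θ, IsWitnessForm θ φ := by
  let θ : arith.BoundedFormula α (n + 1) :=
    substAll (fun a => .var (.inl a)) (fun i => &i.castSucc) φ
  have realize_θ {M : Type} [PeanoModel M] (v : α → M) (xs : Fin n → M) (t : M) :
      θ.Realize v (Fin.snoc xs t : Fin (n + 1) → M) ↔ φ.Realize v xs := by
    simp [θ, Function.comp_def]
  exact ⟨θ, h.substAll _ _, fun v xs => by simp only [realize_θ, exists_const],
    fun v xs s t _ hs => (realize_θ v xs t).2 ((realize_θ v xs s).1 hs)⟩

theorem IsWitnessForm.exists_ex {α : Type} {n : ℕ} {φ : arith.BoundedFormula α (n + 1)}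
    {θ : arith.BoundedFormula α (n + 2)} (hθ : IsWitnessForm θ φ) :
    ∃ θ', IsWitnessForm θ' (∃' φ) := by
  let θ' : arith.BoundedFormula α (n + 1) :=
    bexLe (&(Fin.last n)) (substAll (fun a => .var (.inl a)) (Fin.snoc
      (Fin.snoc (fun i => &i.castSucc.castSucc) (&(Fin.last (n + 1)))) (&(Fin.last n).castSucc)) θ)
  have realize_θ' {M : Type} [PeanoModel M] (v : α → M) (xs : Fin n → M) (t : M) :
      θ'.Realize v (Fin.snoc xs t : Fin (n + 1) → M) ↔
        ∃ a ≤ t, θ.Realize v (Fin.snoc (Fin.snoc xs a : Fin (n + 1) → M) t) := by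
    simp only [θ', realize_bexLe, realize_substAll, Fin.comp_snoc]
    simp [Function.comp_def]
  refine ⟨θ', .bex _ (hθ.isDelta0.substAll _ _), fun v xs => ?_, fun v xs s t hst => ?_⟩
  · simp only [BoundedFormula.realize_ex, hθ.realize_iff, realize_θ']
    refine ⟨fun ⟨a, t, h⟩ => ?_, fun ⟨t, a, _, h⟩ => ⟨a, t, h⟩⟩
    exact ⟨max a t, a, le_max_left a t, hθ.mono v _ (le_max_right a t) h⟩
  · simp only [realize_θ']
    exact fun ⟨a, ha, h⟩ => ⟨a, ha.trans hst, hθ.mono v _ hst h⟩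

theorem IsSigma1.exists_isWitnessForm {α : Type} {n : ℕ} {φ : arith.BoundedFormula α n}
    (h : IsSigma1 φ) : ∃ θ, IsWitnessForm θ φ := by
  induction h with
  | of_delta0 h => exact exists_isWitnessForm_of_isDelta0 h
  | ex _ ih => exact ih.elim fun θ hθ => hθ.exists_ex

section WitnessForm

variable {α : Type} {φ : arith.Formula α} {θ : arith.BoundedFormula α 1} {M : Type} [PeanoModel M]

theorem IsWitnessForm.realize_formula_iff (h : IsWitnessForm θ φ) (v : α → M) :
    φ.Realize v ↔ ∃ t, θ.Realize v ![t] := by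
  simpa [Formula.Realize, Matrix.empty_eq] using h.realize_iff v default

theorem IsWitnessForm.monotone_realize (h : IsWitnessForm θ φ) (v : α → M) :
    Monotone fun t => θ.Realize v ![t] := by
  simpa [Matrix.empty_eq] using h.mono v default

end WitnessForm

section BoundedFormulas

variable {M : Type} [PeanoModel M] {α : Type} {n : ℕ}

/-- The iterated product `t · … · t` of `e` factors. -/
def tPow (t : arith.Term α) : ℕ → arith.Term α
  | 0 => numeral 1
  | e + 1 => tMul (tPow t e) t

@[simp]
theorem realize_tPow (t : arith.Term α) (e : ℕ) (v : α → M) :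
    (tPow t e).realize v = t.realize v ^ e := by
  induction e with
  | zero => rw [tPow, realize_numeral, Nat.cast_one, pow_zero]
  | succ e ih => rw [tPow, realize_tMul, ih, pow_succ]

/-- A bounded formula equivalent to `isPowTwo P`. The lower bound on `P` is needed because only
divisors of a number other than `0` are bounded by it. -/
def isPowTwoBdd (P : arith.Term (α ⊕ Fin n)) : arith.BoundedFormula α n :=
  fLe (numeral 1) P ⊓ ballLe P (ballLe (liftTerm P)
    (fEq (tMul (&((Fin.last n).castSucc)) (&(Fin.last (n + 1)))) (liftTerm (liftTerm P)) ⟹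
      (fEq (&((Fin.last n).castSucc)) (numeral 1) ⊔ bexLe (&((Fin.last n).castSucc))
        (fEq (&((Fin.last n).castSucc.castSucc)) (tAdd (&(Fin.last (n + 2)))
          (&(Fin.last (n + 2))))))))

theorem isDelta0_isPowTwoBdd (P : arith.Term (α ⊕ Fin n)) : IsDelta0 (isPowTwoBdd P) :=
  (isDelta0_fLe _ _).inf <| .ball _ <| .ball _ <|
    (isDelta0_fEq _ _).imp <| (isDelta0_fEq _ _).sup <| .bex _ <| isDelta0_fEq _ _

@[simp]
theorem realize_isPowTwoBdd (P : arith.Term (α ⊕ Fin n)) (v : α → M) (xs : Fin n → M) :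
    (isPowTwoBdd P).Realize v xs ↔ IsPowTwo (P.realize (Sum.elim v xs)) := by
  simp only [isPowTwoBdd, BoundedFormula.realize_inf, realize_fLe, realize_numeral, realize_ballLe,
    BoundedFormula.realize_imp, realize_fEq, realize_tMul, realize_liftTerm,
    BoundedFormula.realize_sup, realize_bexLe, realize_tAdd, Function.comp_apply,
    Term.realize_var, Sum.elim_inr, Fin.snoc_last, Fin.snoc_castSucc, Nat.cast_one]
  set P := P.realize (Sum.elim v xs)
  refine ⟨fun ⟨hP, h⟩ d hd => ?_, fun hP => ⟨hP.one_le, fun d _ e _ hde => ?_⟩⟩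
  · have hP0 : P ≠ 0 := (one_pos.trans_le hP).ne'
    obtain ⟨e, he⟩ := hd
    exact (h d (le_of_dvd ⟨e, he⟩ hP0) e (le_of_dvd (he ▸ dvd_mul_left e d) hP0) he.symm).imp_right
      fun ⟨k, _, hk⟩ => ⟨k, hk⟩
  · exact (hP d ⟨e, hde.symm⟩).imp_right fun ⟨k, hk⟩ => ⟨k, hk ▸ le_self_add, hk⟩

/-- The last variable is the least element of the set defined by `φ`. -/
def fLeast (φ : arith.BoundedFormula α (n + 1)) : arith.BoundedFormula α (n + 1) :=
  φ ⊓ ballLe (&(Fin.last n)) (substAll (fun a => .var (.inl a))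
      (Fin.snoc (fun i => &i.castSucc.castSucc) (&(Fin.last (n + 1)))) φ ⟹
    fLe (&((Fin.last n).castSucc)) (&(Fin.last (n + 1))))

theorem isDelta0_fLeast {φ : arith.BoundedFormula α (n + 1)} (h : IsDelta0 φ) :
    IsDelta0 (fLeast φ) :=
  h.inf <| .ball _ <| (h.substAll _ _).imp <| isDelta0_fLe _ _

@[simp]
theorem realize_fLeast (φ : arith.BoundedFormula α (n + 1)) (v : α → M) (xs : Fin n → M) (a : M) :
    (fLeast φ).Realize v (Fin.snoc xs a : Fin (n + 1) → M) ↔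
      IsLeast {b | φ.Realize v (Fin.snoc xs b : Fin (n + 1) → M)} a := by
  simp only [fLeast, BoundedFormula.realize_inf, realize_ballLe, BoundedFormula.realize_imp,
    realize_substAll, realize_fLe, Fin.comp_snoc, Function.comp_apply, Term.realize_var,
    Sum.elim_inr, Fin.snoc_last, Fin.snoc_castSucc]
  simp only [Function.comp_def, Term.realize_var, Sum.elim_inl, Sum.elim_inr, Fin.snoc_castSucc]
  refine and_congr_right fun _ => ⟨fun h b hb => ?_, fun h b _ hb => h hb⟩
  exact (le_total a b).elim id fun hba => h b hba hb

end BoundedFormulas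

section Languages

variable {M : Type} [PeanoModel M] {U V : arith.Formula (Fin 2)}

theorem isPrefixLanguage_of_forall_model (hV : IsSigma1 V)
    (hfun : ∀ (M : Type) [PeanoModel M] (p x y : M),
      V.Realize ![p, x] → V.Realize ![p, y] → x = y)
    (hpre : ∀ (M : Type) [PeanoModel M] (p q x y R r : M), V.Realize ![p, x] → V.Realize ![q, y] →
      IsPowTwo R → r < R → q + 1 = (p + 1) * R + r → p = q) : IsPrefixLanguage V where
  sigma1 := hV
  functional := models_PA_iff.2 fun M _ => by
    simp only [Sentence.Realize, Formula.Realize, BoundedFormula.realize_all,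
      BoundedFormula.realize_imp, realize_app₂, realize_fEq]
    exact hfun M
  prefixFree := models_PA_iff.2 fun M _ => by
    simp only [Sentence.Realize, Formula.Realize, BoundedFormula.realize_all,
      BoundedFormula.realize_imp, realize_app₂, realize_fEq, isPrefix, BoundedFormula.realize_ex,
      BoundedFormula.realize_inf, realize_isPowTwo, realize_fLt, realize_tSucc, realize_liftTerm,
      realize_tAdd, realize_tMul, Function.comp_apply, Term.realize_var, Sum.elim_inr,
      Fin.snoc_last, Fin.snoc_castSucc, Order.add_one_le_iff]
    rintro p q x y hp hq ⟨R, hR, r, hr, h⟩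
    exact hpre M p q x y R r hp hq hR hr h

theorem IsLanguage.eq_of_realize (hU : IsLanguage U) {p x y : M} (hx : U.Realize ![p, x])
    (hy : U.Realize ![p, y]) : x = y := by
  have h := models_PA_iff.1 hU.functional M
  simp only [Sentence.Realize, Formula.Realize, BoundedFormula.realize_all,
    BoundedFormula.realize_imp, realize_app₂, realize_fEq] at h
  exact h p x y hx hy

theorem ComplexityLeAdd.exists_realize {c : ℕ} (h : ComplexityLeAdd U V c) {p x : M}
    (hp : V.Realize ![p, x]) :
    ∃ q : M, (∀ R : M, IsPowTwo R → p + 1 < R → q + 1 < 2 ^ c * R) ∧ U.Realize ![q, x] := by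
  have h := models_PA_iff.1 h M
  simp only [Sentence.Realize, Formula.Realize, BoundedFormula.realize_all,
    BoundedFormula.realize_imp, realize_app₂, lenLeAdd, BoundedFormula.realize_ex,
    BoundedFormula.realize_inf, realize_isPowTwo, realize_fLt, realize_tSucc, realize_liftTerm,
    realize_tMul, realize_numeral, Function.comp_apply, Term.realize_var, Sum.elim_inr,
    Fin.snoc_last, Nat.cast_pow, Nat.cast_ofNat, Order.add_one_le_iff] at h
  exact h p x hp

end Languages

section Berry

variable {M : Type} [PeanoModel M]

/-- The strings that no program `q ≤ B` of the language with witness form `θ` outputs within time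
`t`. -/
def unprinted (θ : arith.BoundedFormula (Fin 2) 1) (B t : M) : Set M :=
  {x | ∀ q ≤ B, ¬ θ.Realize ![q, x] ![t]}

/-- The language behind Berry's paradox: its programs are the powers of two `p ≠ 1`, and `p` outputs
the least string that no program `q ≤ p ^ e` of the language with witness form `θ` outputs within
the least time `t` satisfying `C`. -/
def berryLanguage (C : arith.BoundedFormula Empty 1) (θ : arith.BoundedFormula (Fin 2) 1) (e : ℕ) :
    arith.Formula (Fin 2) :=
  ∃' ∃' (substAll Empty.elim ![&0] (fLeast C) ⊓
    (isPowTwoBdd (.var (.inl 0)) ⊓ ∼(fEq (.var (.inl 0)) (numeral 1))) ⊓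
    fLeast (ballLe (tPow (.var (.inl 0)) e) (∼(substAll ![&2, &1] ![&0] θ))) ⊓
    fEq (&1) (.var (.inl 1)))

theorem isSigma1_berryLanguage {C : arith.BoundedFormula Empty 1}
    {θ : arith.BoundedFormula (Fin 2) 1} (hC : IsDelta0 C) (hθ : IsDelta0 θ) (e : ℕ) :
    IsSigma1 (berryLanguage C θ e) :=
  .ex <| .ex <| .of_delta0 <| IsDelta0.inf (IsDelta0.inf (IsDelta0.inf
    ((isDelta0_fLeast hC).substAll _ _) ((isDelta0_isPowTwoBdd _).inf (isDelta0_fEq _ _).not))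
    (isDelta0_fLeast (.ball _ (hθ.substAll _ _).not))) (isDelta0_fEq _ _)

theorem realize_berryLanguage (C : arith.BoundedFormula Empty 1)
    (θ : arith.BoundedFormula (Fin 2) 1) (e : ℕ) (p x : M) :
    (berryLanguage C θ e).Realize ![p, x] ↔ ∃ t, IsLeast {t | C.Realize default ![t]} t ∧
      (IsPowTwo p ∧ p ≠ 1) ∧ IsLeast (unprinted θ (p ^ e) t) x := by
  have realize_least₁ (t : M) : (fLeast C).Realize default ![t] ↔
      IsLeast {t | C.Realize default ![t]} t := by
    simpa using realize_fLeast C default ![] t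
  have realize_least₂ (φ : arith.BoundedFormula (Fin 2) 2) (t y : M) :
      (fLeast φ).Realize ![p, x] ![t, y] ↔ IsLeast {b | φ.Realize ![p, x] ![t, b]} y := by
    simpa using realize_fLeast φ ![p, x] ![t] y
  simp [-realize_substAll, berryLanguage, Formula.Realize, realize_substAll_vec₁,
    realize_substAll_vec₂, unprinted, Matrix.empty_eq, realize_least₁, realize_least₂, and_assoc]

theorem isPrefixLanguage_berryLanguage {C : arith.BoundedFormula Empty 1}
    {θ : arith.BoundedFormula (Fin 2) 1} (hC : IsDelta0 C) (hθ : IsDelta0 θ) (e : ℕ) :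
    IsPrefixLanguage (berryLanguage C θ e) := by
  refine isPrefixLanguage_of_forall_model (isSigma1_berryLanguage hC hθ e)
    (fun M _ p x y hx hy => ?_) fun M _ p q x y R r hx hy hR hr h => ?_
  · obtain ⟨t, ht, -, hx⟩ := (realize_berryLanguage C θ e p x).1 hx
    obtain ⟨s, hs, -, hy⟩ := (realize_berryLanguage C θ e p y).1 hy
    obtain rfl := ht.unique hs
    exact hx.unique hy
  · obtain ⟨-, -, ⟨hp, hp1⟩, -⟩ := (realize_berryLanguage C θ e p x).1 hx
    obtain ⟨-, -, ⟨hq, -⟩, -⟩ := (realize_berryLanguage C θ e q y).1 hy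
    exact hp.eq_of_add_one_eq hq hR hp1 hr h

end Berry

section Complexity

theorem strCode_append_singleton (s : List Bool) (b : Bool) :
    strCode (s ++ [b]) = 2 * strCode s + 1 + b.toNat := by
  simp [strCode]

theorem two_pow_length_le_strCode_add_one (s : List Bool) : 2 ^ s.length ≤ strCode s + 1 := by
  induction s using List.reverseRecOn with
  | nil => simp [strCode]
  | append_singleton s b ih =>
    rw [strCode_append_singleton, List.length_append, List.length_singleton, pow_succ]
    omega

theorem strCode_add_one_lt_two_pow (s : List Bool) : strCode s + 1 < 2 ^ (s.length + 1) := by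
  induction s using List.reverseRecOn with
  | nil => simp [strCode]
  | append_singleton s b ih =>
    rw [strCode_append_singleton, List.length_append, List.length_singleton, pow_succ]
    have := Bool.toNat_le b
    omega

theorem strCode_add_one_lt_two_pow_iff {s : List Bool} {k : ℕ} :
    strCode s + 1 < 2 ^ k ↔ s.length < k :=
  ⟨fun h => (Nat.pow_lt_pow_iff_right one_lt_two).1
      ((two_pow_length_le_strCode_add_one s).trans_lt h),
    fun h => (strCode_add_one_lt_two_pow s).trans_le (Nat.pow_le_pow_right two_pos h)⟩

theorem strCode_surjective : Function.Surjective strCode := fun m => by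
  induction m using Nat.strong_induction_on with
  | _ m ih =>
    rcases m with _ | m
    · exact ⟨[], rfl⟩
    · obtain ⟨s, hs⟩ := ih (m / 2) (by omega)
      refine ⟨s ++ [decide (m % 2 = 1)], ?_⟩
      rw [strCode_append_singleton, hs]
      rcases Nat.mod_two_eq_zero_or_one m with h | h <;> simp [h] <;> omega

variable {M : Type} [PeanoModel M] {U : arith.Formula (Fin 2)}

theorem exists_length_eq_complexity {x : List Bool} (h : ∃ p, Outputs U p x) :
    ∃ p, p.length = complexity U x ∧ Outputs U p x :=
  let ⟨p, hp⟩ := h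
  Nat.sInf_mem (s := {k | ∃ p : List Bool, p.length = k ∧ Outputs U p x}) ⟨_, p, rfl, hp⟩

theorem realize_sentKLt (x : List Bool) (k : ℕ) :
    M ⊨ sentKLt U x k ↔ ∃ q : M, q + 1 < 2 ^ k ∧ U.Realize ![q, (strCode x : M)] := by
  simp only [sentKLt, Sentence.Realize, Formula.Realize, BoundedFormula.realize_ex,
    BoundedFormula.realize_inf, realize_fLt, realize_tSucc, realize_numeral, realize_app₂,
    Order.add_one_le_iff, Nat.cast_pow, Nat.cast_ofNat]
  rfl

theorem realize_sentKLt_mono (x : List Bool) : Monotone fun k => M ⊨ sentKLt U x k := by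
  intro k l hkl
  simp only [realize_sentKLt]
  exact fun ⟨q, hq, hU⟩ => ⟨q, hq.trans_le (pow_le_pow_right₀ one_le_two hkl), hU⟩

theorem realize_sentKLt_nat_iff {x : List Bool} (hx : ∃ p, Outputs U p x) {k : ℕ} :
    ℕ ⊨ sentKLt U x k ↔ complexity U x < k := by
  rw [realize_sentKLt]
  constructor
  · rintro ⟨q, hq, h⟩
    obtain ⟨p, rfl⟩ := strCode_surjective q
    have hK : complexity U x ≤ p.length := Nat.sInf_le ⟨p, rfl, h⟩
    exact hK.trans_lt (strCode_add_one_lt_two_pow_iff.1 hq)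
  · intro h
    obtain ⟨p, hp, hpx⟩ := exists_length_eq_complexity hx
    exact ⟨strCode p, strCode_add_one_lt_two_pow_iff.2 (hp ▸ h), hpx⟩

theorem IsSigma1.exists_sentence_iff_sentKLt (hU : IsSigma1 U) (x : List Bool) (k : ℕ) :
    ∃ τ : arith.Sentence, IsSigma1 τ ∧
      ∀ (M : Type) [PeanoModel M], M ⊨ τ ↔ M ⊨ sentKLt U x k := by
  obtain ⟨θ, hθ⟩ := hU.exists_isWitnessForm
  refine ⟨∃' ∃' (fLt (tSucc (&0)) (numeral (2 ^ k)) ⊓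
    substAll ![&0, numeral (strCode x)] ![&1] θ), .ex <| .ex <| .of_delta0 <|
      (isDelta0_fLe _ _).inf (hθ.isDelta0.substAll _ _), fun M _ => ?_⟩
  simp only [realize_sentKLt, hθ.realize_formula_iff]
  simp [-realize_substAll, Sentence.Realize, Formula.Realize, realize_substAll_vec₂,
    Matrix.empty_eq]

theorem exists_realize_of_optimal (hopt : ∀ V, IsPrefixLanguage V → ∃ c, ComplexityLeAdd U V c)
    (x : ℕ) : ∃ p : M, U.Realize ![p, (x : M)] := by
  let V : arith.Formula (Fin 2) :=
    fEq (.var (.inl 0)) (numeral 0) ⊓ fEq (.var (.inl 1)) (numeral x)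
  have realize_V {M : Type} [PeanoModel M] (p y : M) : V.Realize ![p, y] ↔ p = 0 ∧ y = x := by
    simp [V, Formula.Realize]
  have hV : IsPrefixLanguage V := by
    refine isPrefixLanguage_of_forall_model
      (.of_delta0 ((isDelta0_fEq _ _).inf (isDelta0_fEq _ _))) ?_ ?_
    · simp only [realize_V]
      exact fun M _ p y z hy hz => hy.2.trans hz.2.symm
    · simp only [realize_V]
      exact fun M _ p q y z R r hp hq _ _ _ => hp.1.trans hq.1.symm
  obtain ⟨c, hc⟩ := hopt V hV
  obtain ⟨q, -, hq⟩ := hc.exists_realize ((realize_V (0 : M) x).2 ⟨rfl, rfl⟩)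
  exact ⟨q, hq⟩

theorem exists_outputs_of_optimal (hopt : ∀ V, IsPrefixLanguage V → ∃ c, ComplexityLeAdd U V c)
    (x : List Bool) : ∃ p, Outputs U p x := by
  obtain ⟨q, hq⟩ := exists_realize_of_optimal (M := ℕ) hopt (strCode x)
  obtain ⟨p, rfl⟩ := strCode_surjective q
  exact ⟨p, hq⟩

end Complexity

section Soundness

variable {M : Type} [PeanoModel M] {U : arith.Formula (Fin 2)}

/-- Soundness of a model for existential sentences: those true in `M` are true in `ℕ`. -/
def IsSigma1Sound (M : Type) [PeanoModel M] : Prop :=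
  ∀ τ : arith.Sentence, IsSigma1 τ → M ⊨ τ → ℕ ⊨ τ

theorem models_trueUniversal_iff : M ⊨ trueUniversal ↔ IsSigma1Sound M := by
  constructor
  · intro h τ hτ hM
    obtain ⟨π, hπ, realize_π⟩ := hτ.exists_not
    by_contra hN
    have hπM : M ⊨ π := h.realize_of_mem π ⟨hπ, (realize_π ℕ _ _).2 hN⟩
    exact (realize_π M _ _).1 hπM hM
  · intro h
    refine ⟨fun π hπ => ?_⟩
    obtain ⟨τ, hτ, realize_τ⟩ := hπ.1.exists_not
    by_contra hM
    exact (realize_τ ℕ _ _).1 (h τ hτ ((realize_τ M _ _).2 hM)) hπ.2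

theorem IsSigma1.realize_of_realize_nat {τ : arith.Sentence} (hτ : IsSigma1 τ) (h : ℕ ⊨ τ) :
    M ⊨ τ := by
  have h := hτ.realize_embedding (natCastEmbedding M) (isLowerSet_range_natCastEmbedding M) h
  rwa [Unique.eq_default (_ ∘ _), Unique.eq_default (_ ∘ _)] at h

theorem IsSigma1Sound.realize_sentKLt_iff (h : IsSigma1Sound M) (hU : IsSigma1 U) (x : List Bool)
    (k : ℕ) : M ⊨ sentKLt U x k ↔ ℕ ⊨ sentKLt U x k := by
  obtain ⟨τ, hτ, realize_τ⟩ := hU.exists_sentence_iff_sentKLt x k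
  rw [← realize_τ M, ← realize_τ ℕ]
  exact ⟨h τ hτ, hτ.realize_of_realize_nat⟩

theorem exists_isLeast_witness_forall_natCast_le {τ : arith.Sentence}
    {C : arith.BoundedFormula Empty 1} (hC : IsWitnessForm C τ) (hM : M ⊨ τ) (hN : ¬ ℕ ⊨ τ) :
    ∃ t : M, IsLeast {t | C.Realize default ![t]} t ∧ ∀ k : ℕ, (k : M) ≤ t := by
  obtain ⟨t, ht⟩ := exists_isLeast_of_formula C default (S := {t : M | C.Realize default ![t]})
    (by simp [Matrix.empty_eq]) ((hC.realize_formula_iff _).1 hM)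
  refine ⟨t, ht, fun k => ?_⟩
  by_contra! htk
  obtain ⟨j, -, rfl⟩ := exists_natCast_eq_of_le htk.le
  refine hN ((hC.realize_formula_iff _).2 ⟨j, (hC.isDelta0.realize_natCast_iff (M := M) _ _).1 ?_⟩)
  rw [Unique.eq_default (_ ∘ _), ← FinVec.map_eq]
  exact ht.1

theorem mul_le_complexity_of_mem_unprinted {θ : arith.BoundedFormula (Fin 2) 1}
    (hθ : IsWitnessForm θ U) {x : List Bool} (hx : ∃ p, Outputs U p x) {k : ℕ} {t : M}
    (ht : ∀ k : ℕ, (k : M) ≤ t) (h : (strCode x : M) ∈ unprinted θ (2 ^ k) t) :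
    k ≤ complexity U x := by
  obtain ⟨p, hp, hpx⟩ := exists_length_eq_complexity hx
  obtain ⟨s, hs⟩ := (hθ.realize_formula_iff _).1 hpx
  by_contra! hlt
  have hpB : (strCode p : M) ≤ 2 ^ k := by
    have := (strCode_add_one_lt_two_pow_iff.2 (hp.trans_lt hlt)).le
    exact_mod_cast (Nat.le_succ _).trans this
  have hsM := (hθ.isDelta0.realize_natCast_iff (M := M) ![strCode p, strCode x] ![s]).2 hs
  rw [← FinVec.map_eq, ← FinVec.map_eq] at hsM
  exact h _ hpB (hθ.monotone_realize _ (ht s) hsM)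

theorem exists_mul_le_complexity_and_realize_sentKLt (hU : IsLanguage U)
    (hopt : ∀ V, IsPrefixLanguage V → ∃ c, ComplexityLeAdd U V c) {τ : arith.Sentence}
    (hτ : IsSigma1 τ) (hM : M ⊨ τ) (hN : ¬ ℕ ⊨ τ) (e : ℕ) :
    ∃ m, ∀ n, n ≠ 0 → ∃ x, n * e ≤ complexity U x ∧ M ⊨ sentKLt U x (m + (n + 1)) := by
  obtain ⟨C, hC⟩ := hτ.exists_isWitnessForm
  obtain ⟨θ, hθ⟩ := hU.sigma1.exists_isWitnessForm
  obtain ⟨t, ht, hnat⟩ := exists_isLeast_witness_forall_natCast_le hC hM hN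
  obtain ⟨m, hm⟩ := hopt _ (isPrefixLanguage_berryLanguage hC.isDelta0 hθ.isDelta0 e)
  refine ⟨m, fun n hn => ?_⟩
  obtain ⟨y, hy⟩ := exists_natCast_forall_le_not (R := fun q x => θ.Realize ![q, x] ![t])
    (fun q x y hx hy => hU.eq_of_realize ((hθ.realize_formula_iff _).2 ⟨t, hx⟩)
      ((hθ.realize_formula_iff _).2 ⟨t, hy⟩)) (2 ^ (n * e))
  obtain ⟨a, ha⟩ : ∃ a : ℕ, IsLeast (unprinted θ (2 ^ (n * e)) t) (a : M) :=
    exists_isLeast_natCast (by exact_mod_cast hy)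
  obtain ⟨x, rfl⟩ := strCode_surjective a
  refine ⟨x,
    mul_le_complexity_of_mem_unprinted hθ (exists_outputs_of_optimal hopt x) hnat ha.1, ?_⟩
  have one_lt : (1 : M) < 2 ^ n := one_lt_pow₀ one_lt_two hn
  have hberry : (berryLanguage C θ e).Realize ![(2 : M) ^ n, (strCode x : M)] :=
    (realize_berryLanguage C θ e _ _).2
      ⟨t, ht, ⟨.two_pow n, one_lt.ne'⟩, by rwa [← pow_mul]⟩
  obtain ⟨q, hq, hqx⟩ := hm.exists_realize hberry
  refine (realize_sentKLt x _).2 ⟨q, ?_, hqx⟩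
  rw [pow_add]
  refine hq _ (.two_pow (n + 1)) ?_
  rw [pow_succ, mul_two]
  gcongr

theorem isSigma1Sound_of_not_realize_sentKLt (hU : IsLanguage U)
    (hopt : ∀ V, IsPrefixLanguage V → ∃ c, ComplexityLeAdd U V c) {ε : ℝ} (hε : 0 < ε)
    {b : List Bool → ℕ} (hb : ∀ x, 0 < complexity U x → ε * complexity U x ≤ b x)
    (hM : ∀ x, 0 < complexity U x → ¬ M ⊨ sentKLt U x (b x)) : IsSigma1Sound M := by
  intro τ hτ hτM
  by_contra hτN
  obtain ⟨e, he⟩ := exists_nat_ge (2 / ε)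
  obtain ⟨m, hm⟩ := exists_mul_le_complexity_and_realize_sentKLt hU hopt hτ hτM hτN e
  obtain ⟨x, hx, hxM⟩ := hm (m + 1) m.succ_ne_zero
  have he : 2 ≤ ε * e := by rwa [div_le_iff₀' hε] at he
  have he0 : 0 < e := by
    have : (0 : ℝ) < e := pos_of_mul_pos_right (two_pos.trans_le he) hε.le
    exact_mod_cast this
  have hpos : 0 < complexity U x := (Nat.mul_pos m.succ_pos he0).trans_le hx
  refine hM x hpos (realize_sentKLt_mono x ?_ hxM)
  have : (m + (m + 1 + 1) : ℝ) ≤ b x := calc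
    (m + (m + 1 + 1) : ℝ) = (m + 1) * 2 := by ring
    _ ≤ (m + 1) * (ε * e) := by gcongr
    _ = ε * ((m + 1) * e : ℝ) := by ring
    _ ≤ ε * complexity U x := by gcongr; exact_mod_cast hx
    _ ≤ b x := hb x hpos
  exact_mod_cast this

end Soundness

section Theories

variable {M : Type} [PeanoModel M] {U : arith.Formula (Fin 2)}

theorem IsSigma1Sound.realize_sentKLt_iff_complexity_lt (h : IsSigma1Sound M) (hU : IsSigma1 U)
    {x : List Bool} (hx : ∃ p, Outputs U p x) {k : ℕ} :
    M ⊨ sentKLt U x k ↔ complexity U x < k :=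
  (h.realize_sentKLt_iff hU x k).trans (realize_sentKLt_nat_iff hx)

theorem models_exactAxioms_iff (hU : IsLanguage U)
    (hopt : ∀ V, IsPrefixLanguage V → ∃ c, ComplexityLeAdd U V c) :
    M ⊨ exactAxioms U ↔ IsSigma1Sound M := by
  have realize_sentKEq (x : List Bool) (k : ℕ) :
      M ⊨ sentKEq U x k ↔ M ⊨ sentKLt U x (k + 1) ∧ ¬ M ⊨ sentKLt U x k :=
    BoundedFormula.realize_inf
  constructor
  · intro h
    refine isSigma1Sound_of_not_realize_sentKLt hU hopt one_pos (b := complexity U)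
      (fun x _ => (one_mul _).le) fun x _ => ?_
    exact ((realize_sentKEq x _).1 (h.realize_of_mem _ ⟨x, rfl⟩)).2
  · intro h
    refine ⟨?_⟩
    rintro _ ⟨x, rfl⟩
    have hx := exists_outputs_of_optimal hopt x
    simp [realize_sentKEq, h.realize_sentKLt_iff_complexity_lt hU.sigma1 hx]

theorem models_lowerBoundAxioms_iff (hU : IsLanguage U)
    (hopt : ∀ V, IsPrefixLanguage V → ∃ c, ComplexityLeAdd U V c) {ε : ℝ} (hε : 0 < ε)
    {c : List Bool → ℝ}
    (hc : ∀ x, 0 < complexity U x → ε * complexity U x ≤ c x ∧ c x < complexity U x) :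
    M ⊨ lowerBoundAxioms U c ↔ IsSigma1Sound M := by
  constructor
  · intro h
    refine isSigma1Sound_of_not_realize_sentKLt hU hopt hε (b := fun x => ⌊c x⌋₊ + 1)
      (fun x hx => ?_) fun x hx => ?_
    · exact (hc x hx).1.trans (by exact_mod_cast (Nat.lt_floor_add_one (c x)).le)
    · exact (Sentence.realize_not M).1 (h.realize_of_mem _ ⟨x, hx, rfl⟩)
  · intro h
    refine ⟨?_⟩
    rintro _ ⟨x, hx, rfl⟩
    have floor_lt : ⌊c x⌋₊ < complexity U x := (Nat.floor_lt' hx.ne').2 (hc x hx).2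
    rw [sentKGt, Sentence.realize_not, sentKLe,
      h.realize_sentKLt_iff_complexity_lt hU.sigma1 (exists_outputs_of_optimal hopt x)]
    exact (Nat.succ_le_of_lt floor_lt).not_gt

end Theories

end KolmogorovArithmetic

theorem proposition4_general (U : arith.Formula (Fin 2)) (hU : IsLanguage U)
    (hopt : ∀ V, IsPrefixLanguage V → ∃ c, ComplexityLeAdd U V c) :
    SameTheorems (PA ∪ exactAxioms U) (PA ∪ trueUniversal) ∧
    ∀ ε > 0, ∀ c : List Bool → ℝ,
      (∀ x, 0 < complexity U x → ε * complexity U x ≤ c x ∧ c x < complexity U x) →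
      SameTheorems (PA ∪ lowerBoundAxioms U c) (PA ∪ trueUniversal) :=
  ⟨sameTheorems_of_models fun _ _ =>
    (models_exactAxioms_iff hU hopt).trans models_trueUniversal_iff.symm,
  fun _ hε _ hc => sameTheorems_of_models fun _ _ =>
    (models_lowerBoundAxioms_iff hU hopt hε hc).trans models_trueUniversal_iff.symm⟩

theorem proposition4 (U : arith.Formula (Fin 2)) (hU : IsOptimalPlain U ∨ IsOptimalPrefix U) :
    SameTheorems (PA ∪ exactAxioms U) (PA ∪ trueUniversal) ∧
    ∀ c : List Bool → ℝ,
      (∀ x, 0 < complexity U x → (complexity U x : ℝ) / 2 ≤ c x ∧ c x < complexity U x) →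
      SameTheorems (PA ∪ lowerBoundAxioms U c) (PA ∪ trueUniversal) := by
  have h := proposition4_general U (hU.elim (·.toIsLanguage) (·.toIsLanguage))
    (hU.elim (fun h V hV => h.optimal V hV.toIsLanguage) (·.optimal))
  exact ⟨h.1, fun c hc => h.2 (1 / 2) one_half_pos c fun x hx => by
    simpa only [one_div_mul_eq_div] using hc x hx⟩
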